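/- Let $\mathbf{T}^2=(\mathbf{R}/\mathbf{Z})^2$ with Lebesgue probability measure $\mathrm{Leb}$, and let $\mathrm{Homeo}(\mathbf{T}^2,\mathrm{Leb})$ be the set of homeomorphisms of $\mathbf{T}^2$ preserving $\mathrm{Leb}$ (conservative homeomorphisms), with the metric of uniform convergence. Let $\mathcal P$ be the set of Borel probability measures on $\mathbf{T}^2$ with the weak-* topology. For $f\in\mathrm{Homeo}(\mathbf{T}^2,\mathrm{Leb})$ and $x\in\mathbf{T}^2$ let $p\omega(x)\subset\mathcal P$ be the set of limit points of the sequence $\left(\frac1n\sum_{k=0}^{n-1}\delta_{f^k(x)}\right)_{n\ge 1}$. Given a distance $\operatorname{dist}$ on $\mathcal P$ compatible with the weak-* topology, a measure $\mu\in\mathcal P$ is *observable* for $f$ if for every $\varepsilon>0$ the set $\{x\in\mathbf{T}^2 \mid \exists \nu\in p\omega(x),\ \operatorname{dist}(\nu,\mu)<\varepsilon\}$ has positive Lebesgue measure; $\operatorname{Obs}(f)$ denotes the set of observable measures. An $f$-invariant measure $\mu\in\mathcal P$ is *physical* for $f$ if the set of points $x\in\mathbf{T}^2$ such that $\frac1n\sum_{k=0}^{n-1}\delta_{f^k(x)}\to\mu$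 weakly-* as $n\to\infty$ has positive Lebesgue measure. **Lemma.** There is a dense $G_\delta$ subset $G$ of $\mathrm{Homeo}(\mathbf{T}^2,\mathrm{Leb})$ such that for every $f\in G$: for every distance $\operatorname{dist}$ compatible with the weak-* topology, $\operatorname{Obs}(f)=\{\mathrm{Leb}\}$; and the set of physical measures of $f$ is also $\{\mathrm{Leb}\}$. The same holds with $\mathrm{Homeo}(\mathbf{T}^2,\mathrm{Leb})$ replaced by its subspace of homeomorphisms homotopic to the identity. -/

import Mathlib

open MeasureTheory Filter Topology
open scoped ENNReal

namespace TorusDynamics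

/-- The torus `𝕋² = (ℝ/ℤ)²`. Its `volume` is the product of the Lebesgue measures of the two
circles of length one. -/
abbrev Torus : Type := UnitAddTorus (Fin 2)

/-- Lebesgue measure on the torus, as a probability measure. -/
noncomputable def leb : ProbabilityMeasure Torus :=
  ⟨volume, ⟨by simp [volume_pi, Measure.pi_univ, AddCircle.measure_univ]⟩⟩

/-- `Homeo(𝕋², Leb)`: the homeomorphisms of the torus that preserve Lebesgue measure. -/
structure ConsHomeo where
  /-- The underlying homeomorphism. -/
  toHomeo : Torus ≃ₜ Torus
  measurePreserving : MeasurePreserving toHomeo (volume : Measure Torus) (volume : Measure Torus)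

namespace ConsHomeo

/-- The underlying continuous map of a conservative homeomorphism. -/
def toContinuousMap (f : ConsHomeo) : C(Torus, Torus) := ⟨f.toHomeo, f.toHomeo.continuous⟩

theorem toContinuousMap_injective : Function.Injective toContinuousMap := by
  intro f g h
  obtain ⟨f, hf⟩ := f
  obtain ⟨g, hg⟩ := g
  have hfg : f = g := Homeomorph.ext fun x => DFunLike.congr_fun h x
  subst hfg
  rfl

/-- The metric of uniform convergence: the distance of `f` and `g` is `sup_x d(f x, g x)`. -/
noncomputable instance : MetricSpace ConsHomeo :=
  MetricSpace.induced toContinuousMap toContinuousMap_injective inferInstance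

/-- Check of the metric: it is the supremum distance. -/
theorem dist_le_iff (f g : ConsHomeo) {C : ℝ} (hC : 0 ≤ C) :
    dist f g ≤ C ↔ ∀ x, dist (f.toHomeo x) (g.toHomeo x) ≤ C :=
  ContinuousMap.dist_le (f := f.toContinuousMap) (g := g.toContinuousMap) hC

/-- The homeomorphism is homotopic to the identity. -/
def HomotopicToId (f : ConsHomeo) : Prop :=
  f.toContinuousMap.Homotopic (ContinuousMap.id Torus)

end ConsHomeo

/-- A property is generic in a topological space if it holds at every point of
some dense `G_δ` subset. -/
def Generic {X : Type*} [TopologicalSpace X] (P : X → Prop) : Prop :=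
  ∃ G : Set X, IsGδ G ∧ Dense G ∧ ∀ f ∈ G, P f

/-- The empirical measure `1/(n+1) * ∑_{k=0}^{n} δ_{f^k x}` of the first `n + 1` points of the
orbit of `x`. As `n` runs over `0, 1, 2, …`, the length `n + 1` runs over the positive integers. -/
noncomputable def empirical (f : Torus → Torus) (x : Torus) (n : ℕ) : ProbabilityMeasure Torus :=
  ⟨((n + 1 : ℕ) : ℝ≥0∞)⁻¹ • ∑ k ∈ Finset.range (n + 1), Measure.dirac (f^[k] x), ⟨by
    simp only [Measure.smul_apply, Measure.finsetSum_apply, measure_univ, Finset.sum_const,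
      Finset.card_range, smul_eq_mul, nsmul_eq_mul, mul_one]
    exact ENNReal.inv_mul_cancel (by simp) (ENNReal.natCast_ne_top _)⟩⟩

/-- `pω(x)`: the set of limit points (for the weak-* topology, which is Mathlib's topology on
`ProbabilityMeasure`) of the sequence of empirical measures along the orbit of `x`. -/
def pOmega (f : Torus → Torus) (x : Torus) : Set (ProbabilityMeasure Torus) :=
  {ν | MapClusterPt ν atTop (empirical f x)}

/-- A distance on the set of probability measures is compatible with the weak-* topology. -/
def IsCompatible (d : MetricSpace (ProbabilityMeasure Torus)) : Prop :=
  d.toPseudoMetricSpace.toUniformSpace.toTopologicalSpace =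
    (inferInstance : TopologicalSpace (ProbabilityMeasure Torus))

/-- `Obs(f)`: the probability measures `μ` such that for every `ε > 0` the set of points `x` for
which some `ν ∈ pω(x)` satisfies `d(ν, μ) < ε` has positive Lebesgue measure. -/
def Obs (d : MetricSpace (ProbabilityMeasure Torus)) (f : Torus → Torus) :
    Set (ProbabilityMeasure Torus) :=
  {μ | ∀ ε : ℝ, 0 < ε →
    0 < (volume : Measure Torus) {x | ∃ ν ∈ pOmega f x, d.dist ν μ < ε}}

/-- The set of physical measures of `f`: the `f`-invariant probability measures `μ` whose basin,
i.e. the set of points `x` whose empirical measures converge weakly-* to `μ`, has positive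
Lebesgue measure. -/
def Phys (f : Torus → Torus) : Set (ProbabilityMeasure Torus) :=
  {μ | MeasurePreserving f (μ : Measure Torus) (μ : Measure Torus) ∧
    0 < (volume : Measure Torus) {x | Tendsto (empirical f x) atTop (𝓝 μ)}}

/-- For every distance compatible with the weak-* topology, Lebesgue measure is the only
observable measure of `f`, and it is the only physical measure of `f`. -/
def ObsPhysEqLeb (f : ConsHomeo) : Prop :=
  (∀ d : MetricSpace (ProbabilityMeasure Torus), IsCompatible d → Obs d f.toHomeo = {leb}) ∧
    Phys f.toHomeo = {leb}

end TorusDynamics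

/-! It is enough that, for generic `f`, the empirical measures of almost every point converge to
`leb`; both conclusions then follow from uniqueness of limits. Convergence need only be tested on a
countable dense family of continuous `φ` with values in `[0, 1]`. The failure of equidistribution is
measured by `orbitDev`, the mean square distance to `∫ φ` of the averages of `φ` over `n` points of
an orbit of `g^D`. For fixed `φ`, `D`, `n` it depends continuously on the map, so its smallness is
an open condition. If it can be made arbitrarily small by choosing `D` and `n`, the maximal ergodic
theorem yields almost everywhere convergence of the Birkhoff averages
(`ae_tendsto_birkhoffSum_div`). Since `ConsHomeo` is a Baire space, what remains is density:
`exists_dist_lt_orbitDev_lt`.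

Density is probabilistic. Compose `f` with two shears whose displacements are constant on the cells
of a fine partition of the circle, with independent values uniform on `(0, ε]`. If every step used
fresh noise, the orbit would be a Markov chain whose operator contracts the variance of observables
at a rate independent of `f`, because the Fourier coefficients of the noise at nonzero frequencies
are bounded by some `c < 1` (`exists_variance_perturbOp_le`). Frozen displacements differ from fresh
noise only when the orbit reuses a cell. As the noise has bounded density, this is unlikely over a
fixed time horizon once the cells are small (`lintegral_iterate_siteStep_le`, `noiseOp_return_le`).
Hence the correlations at times at least `D`, averaged over the displacements, barely exceed `(∫
φ)^2`, and a second moment argument selects one choice of displacements with small deviation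
(`exists_orbitDev_shearPerturb_le`). The step functions are then made continuous off a set of small
measure, which turns the shears into homeomorphisms.

The class of the identity is open, since uniformly close maps are homotopic, so genericity passes to
it. -/

namespace TorusDynamics

set_option linter.unusedSectionVars false

/-! ### Frozen random environment versus fresh noise -/

section Coupling

variable {E W J : Type*} [MeasurableSpace E] [MeasurableSpace W] [Fintype J] [DecidableEq J]
  [MeasurableSpace J] [DiscreteMeasurableSpace J]

/-- The map driven by an environment `θ` of noises attached to the sites `J`. -/
def siteStep (T : E → W → E) (c : E → J) (θ : J → W) (e : E) : E := T e (θ (c e))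

/-- The Markov operator of the chain driven by fresh independent noise. -/
noncomputable def noiseOp (ν : Measure W) (T : E → W → E) (F : E → ℝ≥0∞) (e : E) : ℝ≥0∞ :=
  ∫⁻ w, F (T e w) ∂ν

/-- Resampling one coordinate of a product measure does not change its law. This isolates the noise
at the initial site from the rest of the environment. -/
theorem lintegral_pi_eq_lintegral_update (ν : Measure W) [IsProbabilityMeasure ν] (j : J)
    {H : (J → W) → ℝ≥0∞} (hH : Measurable H) :
    ∫⁻ θ, H θ ∂Measure.pi (fun _ => ν) =
      ∫⁻ w, ∫⁻ θ, H (Function.update θ j w) ∂Measure.pi (fun _ => ν) ∂ν := by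
  have hm : Measurable fun p : W × (J → W) => H (Function.update p.2 j p.1) :=
    hH.comp (measurable_pi_iff.2 fun i => by
      by_cases h : i = j
      · subst h; simpa using measurable_fst
      · simpa [Function.update_of_ne h, Function.comp_def] using
          (measurable_pi_apply i).comp (measurable_snd (α := W) (β := J → W)))
  rw [lintegral_lintegral_swap hm.aemeasurable]
  obtain ⟨w₀⟩ : Nonempty W := ν.nonempty_of_neZero
  set G : (J → W) → ℝ≥0∞ := fun θ => ∫⁻ w, H (Function.update θ j w) ∂ν with hG
  have hGm : Measurable G := by
    have := (hm.comp measurable_swap).lintegral_prod_right' (ν := ν)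
    exact this
  rw [lintegral_eq_lmarginal_univ (fun _ => w₀), lintegral_eq_lmarginal_univ (fun _ => w₀),
    lmarginal_erase' _ hH (Finset.mem_univ j), lmarginal_erase' _ hGm (Finset.mem_univ j)]
  simp [hG]

variable {T : E → W → E} {c : E → J}

theorem measurable_siteStep (hT : Measurable fun p : E × W => T p.1 p.2) (hc : Measurable c) :
    Measurable fun p : (J → W) × E => siteStep T c p.1 p.2 := by
  have h1 : Measurable fun p : (J → W) × J => p.1 p.2 :=
    measurable_from_prod_countable_left fun j => measurable_pi_apply j
  exact hT.comp (measurable_snd.prodMk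
    (h1.comp (measurable_fst.prodMk (hc.comp measurable_snd))))

theorem measurable_iterate_siteStep (hT : Measurable fun p : E × W => T p.1 p.2)
    (hc : Measurable c) (n : ℕ) :
    Measurable fun p : (J → W) × E => (siteStep T c p.1)^[n] p.2 := by
  induction n with
  | zero => exact measurable_snd
  | succ n ih =>
    simp only [Function.iterate_succ_apply']
    exact (measurable_siteStep hT hc).comp (measurable_fst.prodMk ih)

theorem measurable_noiseOp {ν : Measure W} [SFinite ν]
    (hT : Measurable fun p : E × W => T p.1 p.2) {F : E → ℝ≥0∞} (hF : Measurable F) :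
    Measurable (noiseOp ν T F) :=
  Measurable.lintegral_prod_right' (f := fun p : E × W => F (T p.1 p.2)) (hF.comp hT)

theorem measurable_iterate_noiseOp {ν : Measure W} [SFinite ν]
    (hT : Measurable fun p : E × W => T p.1 p.2) {F : E → ℝ≥0∞} (hF : Measurable F) (n : ℕ) :
    Measurable ((noiseOp ν T)^[n] F) := by
  induction n with
  | zero => exact hF
  | succ n ih =>
    simp only [Function.iterate_succ_apply']
    exact measurable_noiseOp hT ih

/-- The noise at `j` is read only when the orbit visits `j`. -/
theorem iterate_siteStep_update_eq {θ : J → W} {j : J} {w : W} {n : ℕ} {e : E}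
    (h : ∀ k < n, c ((siteStep T c θ)^[k] e) ≠ j) :
    (siteStep T c (Function.update θ j w))^[n] e = (siteStep T c θ)^[n] e := by
  induction n with
  | zero => rfl
  | succ n ih =>
    rw [Function.iterate_succ_apply', Function.iterate_succ_apply',
      ih fun k hk => h k (hk.trans n.lt_succ_self), siteStep, siteStep,
      Function.update_of_ne (h n n.lt_succ_self)]

/-- The recursion for the coupling error, and the origin of the constant `3 ^ n`. -/
theorem sum_one_add_three_pow_le (n : ℕ) :
    3 ^ n + ∑ k ∈ Finset.range n, (1 + 3 ^ k) ≤ 3 ^ (n + 1) := by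
  induction n with
  | zero => simp
  | succ n ih =>
    rw [Finset.sum_range_succ]
    have : 1 ≤ 3 ^ n := Nat.one_le_pow _ _ (by norm_num)
    rw [pow_succ 3 (n + 1), pow_succ 3 n] at *
    omega

/-- If the chain with fresh noise rarely returns to its initial site, then it is close in law to
the chain driven by a random environment. -/
theorem lintegral_iterate_siteStep_le (ν : Measure W) [IsProbabilityMeasure ν]
    (hT : Measurable fun p : E × W => T p.1 p.2) (hc : Measurable c) {κ : ℝ≥0∞}
    (hκ : ∀ e k, (noiseOp ν T)^[k + 1] ({e' | c e' = c e}.indicator 1) e ≤ κ) (n : ℕ) :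
    ∀ F : E → ℝ≥0∞, Measurable F → (∀ e, F e ≤ 1) → ∀ e,
      ∫⁻ θ, F ((siteStep T c θ)^[n] e) ∂Measure.pi (fun _ => ν) ≤
        (noiseOp ν T)^[n] F e + (3 ^ n : ℕ) * κ := by
  have hcm : ∀ j, Measurable ({e' | c e' = j}.indicator (1 : E → ℝ≥0∞)) := fun j =>
    measurable_one.indicator (hc (measurableSet_singleton j))
  induction n using Nat.strong_induction_on with
  | _ n IH =>
  intro F hF hF1 e
  rcases n with _ | n
  · simp
  have hit : ∀ (k : ℕ) (y : E), Measurable fun θ : J → W => (siteStep T c θ)^[k] y := fun k y =>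
    (measurable_iterate_siteStep hT hc k).comp (measurable_id.prodMk measurable_const)
  set j := c e
  -- With the noise at `j` redrawn as `w`, the first step goes to `T e w`. The later orbit ignores
  -- `w` unless it returns to `j`, and each possible return time costs the probability of being at
  -- `j`.
  have key : ∀ w, ∫⁻ θ, F ((siteStep T c (Function.update θ j w))^[n + 1] e)
      ∂Measure.pi (fun _ => ν) ≤ (noiseOp ν T)^[n] F (T e w) + (3 ^ n : ℕ) * κ +
        ∑ k ∈ Finset.range n, ((noiseOp ν T)^[k] ({e' | c e' = j}.indicator 1) (T e w)
          + (3 ^ k : ℕ) * κ) := by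
    intro w
    have h1 : ∀ θ, F ((siteStep T c (Function.update θ j w))^[n + 1] e) ≤
        F ((siteStep T c θ)^[n] (T e w)) + ∑ k ∈ Finset.range n,
          {e' | c e' = j}.indicator 1 ((siteStep T c θ)^[k] (T e w)) := by
      intro θ
      rw [Function.iterate_succ_apply]
      have h2 : siteStep T c (Function.update θ j w) e = T e w := by simp [siteStep, j]
      rw [h2]
      by_cases h : ∀ k < n, c ((siteStep T c θ)^[k] (T e w)) ≠ j
      · rw [iterate_siteStep_update_eq h]
        exact le_self_add
      · push Not at h
        obtain ⟨k, hk, hkj⟩ := h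
        refine (hF1 _).trans (le_trans ?_ le_add_self)
        refine le_trans ?_ (Finset.single_le_sum (f := fun k =>
          {e' | c e' = j}.indicator (1 : E → ℝ≥0∞) ((siteStep T c θ)^[k] (T e w)))
          (fun _ _ => zero_le) (Finset.mem_range.2 hk))
        simp [hkj]
    refine (lintegral_mono h1).trans ?_
    rw [lintegral_add_left (f := fun θ => F ((siteStep T c θ)^[n] (T e w))) (hF.comp (hit n _)),
      lintegral_finsetSum _ (f := fun k θ => {e' | c e' = j}.indicator (1 : E → ℝ≥0∞)
        ((siteStep T c θ)^[k] (T e w))) fun k _ => (hcm j).comp (hit k _)]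
    -- The return probabilities are themselves taken in the random environment, so the induction
    -- hypothesis is also applied to the indicator of the site, at all shorter times.
    refine add_le_add (IH n n.lt_succ_self F hF hF1 _) (Finset.sum_le_sum fun k hk => ?_)
    refine IH k ((Finset.mem_range.1 hk).trans n.lt_succ_self) _ (hcm j) (fun e => ?_) _
    exact Set.indicator_le_self' (fun _ _ => zero_le) e
  rw [lintegral_pi_eq_lintegral_update ν j
    (H := fun θ => F ((siteStep T c θ)^[n + 1] e)) (hF.comp (hit (n + 1) e))]
  refine (lintegral_mono key).trans ?_
  have hTe : Measurable (T e) := hT.comp (measurable_const.prodMk measurable_id)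
  have hm : ∀ k G, Measurable G → Measurable fun w => (noiseOp ν T)^[k] G (T e w) :=
    fun k G hG => (measurable_iterate_noiseOp hT hG k).comp hTe
  rw [lintegral_add_left ((hm n F hF).add_const _), lintegral_add_left (hm n F hF),
    lintegral_finsetSum _ fun k _ => (hm k _ (hcm j)).add_const _, lintegral_const, measure_univ,
    mul_one, add_assoc]
  refine add_le_add (le_of_eq ?_) ?_
  · rw [Function.iterate_succ_apply']; rfl
  calc (3 ^ n : ℕ) * κ + ∑ k ∈ Finset.range n, ∫⁻ w,
        ((noiseOp ν T)^[k] ({e' | c e' = j}.indicator 1) (T e w) + (3 ^ k : ℕ) * κ) ∂ν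
      ≤ (3 ^ n : ℕ) * κ + ∑ k ∈ Finset.range n, (κ + (3 ^ k : ℕ) * κ) := by
        gcongr with k hk
        rw [lintegral_add_left (hm k _ (hcm j)), lintegral_const, measure_univ, mul_one]
        gcongr
        -- Averaging over `w` the `k`-step probability from `T e w` gives the return probability
        -- from `e` at time `k + 1`.
        have := hκ e k
        rw [Function.iterate_succ_apply'] at this
        exact this
    _ = ((3 ^ n + ∑ k ∈ Finset.range n, (1 + 3 ^ k) : ℕ) : ℝ≥0∞) * κ := by
        push_cast
        rw [add_mul, Finset.sum_mul]
        simp only [add_mul, one_mul]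
    _ ≤ (3 ^ (n + 1) : ℕ) * κ := by
        gcongr
        exact sum_one_add_three_pow_le n

end Coupling

/-! ### Maximal ergodic theorem -/

section Maximal

variable {X : Type*} [MeasurableSpace X] {μ : Measure X} {T : X → X}

/-- The maximum of `0` and the first `N` Birkhoff sums of `C`. -/
def maxBirkhoffSum (T : X → X) (C : X → ℝ) : ℕ → X → ℝ
  | 0, _ => 0
  | N + 1, x => max 0 (C x + maxBirkhoffSum T C N (T x))

theorem maxBirkhoffSum_nonneg (C : X → ℝ) (N : ℕ) (x : X) : 0 ≤ maxBirkhoffSum T C N x := by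
  cases N with
  | zero => exact le_rfl
  | succ N => exact le_max_left _ _

theorem maxBirkhoffSum_le_succ (C : X → ℝ) (N : ℕ) (x : X) :
    maxBirkhoffSum T C N x ≤ maxBirkhoffSum T C (N + 1) x := by
  induction N generalizing x with
  | zero => exact maxBirkhoffSum_nonneg C 1 x
  | succ N ih => exact max_le_max le_rfl (add_le_add le_rfl (ih (T x)))

theorem birkhoffSum_le_maxBirkhoffSum (C : X → ℝ) {n N : ℕ} (h : n ≤ N) (x : X) :
    birkhoffSum T C n x ≤ maxBirkhoffSum T C N x := by
  induction N generalizing n x with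
  | zero => simp [Nat.le_zero.1 h, maxBirkhoffSum]
  | succ N ih =>
    rcases n with _ | n
    · simpa using maxBirkhoffSum_nonneg C (N + 1) x
    · rw [birkhoffSum_succ']
      exact (add_le_add le_rfl (ih (Nat.succ_le_succ_iff.1 h) (T x))).trans (le_max_right _ _)

theorem integrable_maxBirkhoffSum (hT : MeasurePreserving T μ μ) {C : X → ℝ}
    (hC : Integrable C μ) (N : ℕ) : Integrable (maxBirkhoffSum T C N) μ := by
  induction N with
  | zero => exact integrable_zero _ _ _
  | succ N ih =>
    exact (integrable_zero X ℝ μ).sup (hC.add (hT.integrable_comp_of_integrable ih))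

theorem measurable_maxBirkhoffSum (hT : Measurable T) {C : X → ℝ} (hC : Measurable C) (N : ℕ) :
    Measurable (maxBirkhoffSum T C N) := by
  induction N with
  | zero => exact measurable_const
  | succ N ih => exact measurable_const.max (hC.add (ih.comp hT))

/-- The maximal ergodic theorem. -/
theorem setIntegral_maxBirkhoffSum_pos_nonneg (hT : MeasurePreserving T μ μ) {C : X → ℝ}
    (hCm : Measurable C) (hC : Integrable C μ) (N : ℕ) :
    0 ≤ ∫ x in {x | 0 < maxBirkhoffSum T C N x}, C x ∂μ := by
  rcases N with _ | N
  · simp [maxBirkhoffSum]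
  set M := maxBirkhoffSum T C (N + 1) with hM
  have hMi : Integrable M μ := integrable_maxBirkhoffSum hT hC _
  have hMT : Integrable (fun x => M (T x)) μ := hT.integrable_comp_of_integrable hMi
  have hA : MeasurableSet {x | 0 < M x} :=
    measurableSet_lt measurable_const (measurable_maxBirkhoffSum hT.measurable hCm _)
  -- Where `M` is positive its value comes from the second term of the maximum, and enlarging the
  -- horizon at `T x` by one only increases it.
  have hle : ∀ x ∈ {x | 0 < M x}, M x - M (T x) ≤ C x := by
    intro x hx
    have h1 : M x = C x + maxBirkhoffSum T C N (T x) := by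
      have h2 : M x = max 0 (C x + maxBirkhoffSum T C N (T x)) := rfl
      rcases max_choice 0 (C x + maxBirkhoffSum T C N (T x)) with h | h
      · rw [h] at h2; exact absurd h2 (ne_of_gt hx)
      · rw [h2, h]
    have := maxBirkhoffSum_le_succ (T := T) C N (T x)
    rw [h1]; linarith
  refine le_trans ?_ (setIntegral_mono_on (f := fun x => M x - M (T x))
    (hMi.sub hMT).integrableOn hC.integrableOn hA hle)
  rw [integral_sub hMi.integrableOn hMT.integrableOn]
  have e1 : ∫ x in {x | 0 < M x}, M x ∂μ = ∫ x, M x ∂μ := by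
    refine setIntegral_eq_integral_of_forall_compl_eq_zero fun x hx => ?_
    exact le_antisymm (not_lt.1 hx) (maxBirkhoffSum_nonneg C _ x)
  have e2 : ∫ x in {x | 0 < M x}, M (T x) ∂μ ≤ ∫ x, M (T x) ∂μ :=
    setIntegral_le_integral hMT (ae_of_all _ fun x => maxBirkhoffSum_nonneg C _ _)
  have e3 : ∫ x, M (T x) ∂μ = ∫ x, M x ∂μ := by
    conv_rhs => rw [← hT.map_eq]
    rw [integral_map hT.measurable.aemeasurable]
    rw [hT.map_eq]; exact hMi.aestronglyMeasurable
  linarith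

/-- The weak type `(1, 1)` inequality for Birkhoff sums of a nonnegative function. -/
theorem measure_exists_lt_birkhoffSum_le [IsFiniteMeasure μ] (hT : MeasurePreserving T μ μ)
    {C : X → ℝ} (hCm : Measurable C) (hC : Integrable C μ) (hC0 : ∀ x, 0 ≤ C x) {l : ℝ}
    (hl : 0 < l) :
    μ {x | ∃ n : ℕ, l * n < birkhoffSum T C n x} ≤ ENNReal.ofReal ((∫ x, C x ∂μ) / l) := by
  set D : X → ℝ := fun x => C x - l
  have hDm : Measurable D := hCm.sub_const l
  have hD : Integrable D μ := hC.sub (integrable_const l)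
  have hsub : {x | ∃ n : ℕ, l * n < birkhoffSum T C n x} ⊆
      ⋃ N : ℕ, {x | 0 < maxBirkhoffSum T D N x} := by
    rintro x ⟨n, hn⟩
    refine Set.mem_iUnion.2 ⟨n, lt_of_lt_of_le ?_ (birkhoffSum_le_maxBirkhoffSum D le_rfl x)⟩
    have : birkhoffSum T D n x = birkhoffSum T C n x - l * n := by
      simp [birkhoffSum, D, Finset.sum_sub_distrib, mul_comm]
    rw [this]; linarith
  refine (measure_mono hsub).trans ?_
  have hmono : Monotone fun N : ℕ => {x | 0 < maxBirkhoffSum T D N x} :=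
    monotone_nat_of_le_succ fun N x (hx : 0 < maxBirkhoffSum T D N x) =>
      lt_of_lt_of_le hx (maxBirkhoffSum_le_succ D N x)
  rw [hmono.measure_iUnion]
  refine iSup_le fun N => ?_
  have h0 := setIntegral_maxBirkhoffSum_pos_nonneg hT hDm hD N
  set A := {x | 0 < maxBirkhoffSum T D N x}
  rw [integral_sub hC.integrableOn (integrable_const l).integrableOn, setIntegral_const,
    smul_eq_mul] at h0
  have h1 : ∫ x in A, C x ∂μ ≤ ∫ x, C x ∂μ := setIntegral_le_integral hC (ae_of_all _ hC0)
  rw [← ENNReal.ofReal_toReal (measure_ne_top μ A)]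
  refine ENNReal.ofReal_le_ofReal ?_
  rw [le_div_iff₀ hl]
  change μ.real A * l ≤ _
  linarith

end Maximal

instance : IsProbabilityMeasure (volume : Measure UnitAddCircle) := ⟨by simp⟩

instance : IsProbabilityMeasure (volume : Measure Torus) :=
  inferInstanceAs (IsProbabilityMeasure (leb : Measure Torus))

/-! ### Uniform noise on the circle and its spectral gap -/

section Noise

/-- The uniform distribution on `(0, ε]`. -/
noncomputable def noise (ε : ℝ) : Measure ℝ :=
  ENNReal.ofReal ε⁻¹ • volume.restrict (Set.Ioc 0 ε)

variable {ε : ℝ}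

theorem isProbabilityMeasure_noise (hε : 0 < ε) : IsProbabilityMeasure (noise ε) := by
  constructor
  simp only [noise, Measure.smul_apply, Measure.restrict_apply MeasurableSet.univ, Set.univ_inter,
    Real.volume_Ioc, sub_zero, smul_eq_mul]
  rw [← ENNReal.ofReal_mul (inv_nonneg.2 hε.le), inv_mul_cancel₀ hε.ne', ENNReal.ofReal_one]

instance : IsFiniteMeasure (noise ε) := by
  exact Measure.smul_finite _ ENNReal.ofReal_ne_top

theorem ae_noise_mem : ∀ᵐ w ∂noise ε, w ∈ Set.Ioc 0 ε :=
  Measure.smul_absolutelyContinuous.ae_le (ae_restrict_mem measurableSet_Ioc)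

/-- The noise has density at most `ε⁻¹` on the circle. -/
theorem lintegral_noise_le (hε1 : ε ≤ 1) {G : UnitAddCircle → ℝ≥0∞} (t : UnitAddCircle) :
    ∫⁻ w, G (t + (w : UnitAddCircle)) ∂noise ε ≤ ENNReal.ofReal ε⁻¹ * ∫⁻ y, G y := by
  rw [noise, lintegral_smul_measure, smul_eq_mul]
  gcongr
  calc ∫⁻ w in Set.Ioc 0 ε, G (t + (w : UnitAddCircle))
      ≤ ∫⁻ w in Set.Ioc (0 : ℝ) (0 + 1), G (t + (w : UnitAddCircle)) :=
        lintegral_mono_set (Set.Ioc_subset_Ioc_right (by simpa using hε1))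
    _ = ∫⁻ y, G (t + y) := UnitAddCircle.lintegral_preimage 0 fun y => G (t + y)
    _ = ∫⁻ y, G y := lintegral_add_left_eq_self G t

/-- For `x ≥ 2` the bound `|sin x| ≤ 1` suffices; below, `sin x = 2 sin (x/2) cos (x/2)` and the
cosine decreases. The constant is uniform in `x ≥ a`, hence over all nonzero frequencies. -/
theorem abs_sin_le_mul {a x : ℝ} (ha : 0 < a) (hax : a ≤ x) :
    |Real.sin x| ≤ max (1 / 2) (Real.cos (a / 2)) * x := by
  have hx : 0 < x := ha.trans_le hax
  rcases le_total 2 x with h | h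
  · calc |Real.sin x| ≤ 1 := Real.abs_sin_le_one x
      _ ≤ 1 / 2 * x := by linarith
      _ ≤ _ := by gcongr; exact le_max_left _ _
  · have hpi := Real.pi_gt_three
    have h1 : 0 ≤ Real.sin (x / 2) := Real.sin_nonneg_of_nonneg_of_le_pi (by linarith) (by linarith)
    have h2 : Real.sin (x / 2) ≤ x / 2 := Real.sin_le (by linarith)
    have h3 : 0 ≤ Real.cos (x / 2) := Real.cos_nonneg_of_neg_pi_div_two_le_of_le
      (by linarith) (by linarith)
    have h4 : Real.cos (x / 2) ≤ Real.cos (a / 2) :=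
      Real.cos_le_cos_of_nonneg_of_le_pi (by linarith) (by linarith) (by linarith)
    have h5 : Real.sin x = 2 * Real.sin (x / 2) * Real.cos (x / 2) := by
      rw [← Real.sin_two_mul]; ring_nf
    rw [h5, abs_of_nonneg (by positivity)]
    calc 2 * Real.sin (x / 2) * Real.cos (x / 2) ≤ 2 * (x / 2) * Real.cos (a / 2) := by gcongr
      _ = Real.cos (a / 2) * x := by ring
      _ ≤ _ := by gcongr; exact le_max_right _ _

/-- The Fourier coefficients of the noise. -/
noncomputable def noiseCoeff (ε : ℝ) (n : ℤ) : ℂ := ∫ w, fourier n (w : UnitAddCircle) ∂noise ε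

theorem norm_noiseCoeff_le_one (hε : 0 < ε) (n : ℤ) : ‖noiseCoeff ε n‖ ≤ 1 := by
  have := isProbabilityMeasure_noise hε
  refine (norm_integral_le_of_norm_le_const (C := 1) (ae_of_all _ fun w => ?_)).trans (by simp)
  exact ((fourier n).norm_coe_le_norm _).trans (fourier_norm n).le

theorem norm_noiseCoeff_eq (hε : 0 < ε) {n : ℤ} (hn : n ≠ 0) :
    ‖noiseCoeff ε n‖ = |Real.sin (Real.pi * |(n : ℝ)| * ε)| / (Real.pi * |(n : ℝ)| * ε) := by
  have hn' : (n : ℝ) ≠ 0 := Int.cast_ne_zero.2 hn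
  have hc : (2 * Real.pi * Complex.I * n : ℂ) ≠ 0 := by
    simp [Real.pi_ne_zero, hn]
  have h1 : noiseCoeff ε n = (ε⁻¹ : ℝ) • ((Complex.exp (2 * Real.pi * Complex.I * n * ε) - 1) /
      (2 * Real.pi * Complex.I * n)) := by
    rw [noiseCoeff, noise, integral_smul_measure, ENNReal.toReal_ofReal (inv_nonneg.2 hε.le),
      ← intervalIntegral.integral_of_le hε.le]
    congr 1
    have := integral_exp_mul_complex (a := 0) (b := ε) hc
    simp only [Complex.ofReal_zero, mul_zero, Complex.exp_zero] at this
    rw [← this]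
    refine intervalIntegral.integral_congr fun w _ => ?_
    simp
  have h2 : (2 * Real.pi * Complex.I * n * ε : ℂ) =
      Complex.I * ((2 * Real.pi * n * ε : ℝ) : ℂ) := by
    push_cast; ring
  rw [h1, h2, norm_smul, norm_div, Complex.norm_exp_I_mul_ofReal_sub_one]
  have h3 : ‖(2 * Real.pi * Complex.I * n : ℂ)‖ = 2 * Real.pi * |(n : ℝ)| := by
    simp [abs_of_pos Real.pi_pos]
  have h4 : |Real.sin (Real.pi * |(n : ℝ)| * ε)| = |Real.sin (Real.pi * n * ε)| := by
    rcases abs_choice (n : ℝ) with h | h <;> rw [h]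
    rw [← abs_neg, ← Real.sin_neg]; congr 2; ring
  rw [h3, h4, norm_mul, Real.norm_eq_abs, Real.norm_eq_abs, Real.norm_eq_abs,
    abs_of_pos (inv_pos.2 hε), abs_two,
    show 2 * Real.pi * n * ε / 2 = Real.pi * n * ε by ring]
  have := abs_pos.2 hn'
  field_simp

theorem exists_norm_noiseCoeff_le (hε : 0 < ε) (hε1 : ε ≤ 1) :
    ∃ c : ℝ, 0 ≤ c ∧ c < 1 ∧ ∀ n : ℤ, n ≠ 0 → ‖noiseCoeff ε n‖ ≤ c := by
  have hpi := Real.pi_pos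
  refine ⟨max (1 / 2) (Real.cos (Real.pi * ε / 2)), by positivity, max_lt (by norm_num) ?_, ?_⟩
  · rw [← Real.cos_zero]
    refine Real.cos_lt_cos_of_nonneg_of_le_pi le_rfl ?_ (by positivity)
    nlinarith
  · intro n hn
    have h1 : 1 ≤ |(n : ℝ)| := by exact_mod_cast Int.one_le_abs hn
    rw [norm_noiseCoeff_eq hε hn, div_le_iff₀ (by positivity)]
    refine abs_sin_le_mul (by positivity) ?_
    gcongr
    nlinarith

end Noise

/-! ### Averaging along translations as a Fourier multiplier -/

section Averaging

variable {ε : ℝ}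

/-- The translation vector `w` in the direction `i`. -/
noncomputable def shiftVec (i : Fin 2) (w : ℝ) : Torus := Pi.single i (w : UnitAddCircle)

theorem continuous_shiftVec (i : Fin 2) : Continuous (shiftVec i) :=
  (continuous_single i).comp (AddCircle.continuous_mk' 1)

theorem integrable_of_continuousMap {X : Type*} [MeasurableSpace X] {μ : Measure X}
    [IsFiniteMeasure μ] {F : Type*} [NormedAddCommGroup F] [SecondCountableTopology F]
    [MeasurableSpace F] [BorelSpace F]
    (φ : C(Torus, F)) {u : X → Torus} (hu : Measurable u) : Integrable (fun x => φ (u x)) μ :=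
  Integrable.of_bound (φ.continuous.measurable.comp hu).aestronglyMeasurable ‖φ‖
    (ae_of_all _ fun _ => φ.norm_coe_le_norm _)

/-- Average of `φ` along translations in the direction `i`. -/
noncomputable def shiftAvg (ε : ℝ) (i : Fin 2) (φ : C(Torus, ℝ)) : C(Torus, ℝ) where
  toFun x := ∫ w, φ (x + shiftVec i w) ∂noise ε
  continuous_toFun := by
    refine continuous_of_dominated (bound := fun _ => ‖φ‖) (fun _ => ?_)
      (fun _ => ae_of_all _ fun w => φ.norm_coe_le_norm _) (integrable_const _)
      (ae_of_all _ fun w => by fun_prop)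
    exact (φ.continuous.comp
      (continuous_const.add (continuous_shiftVec i))).measurable.aestronglyMeasurable

theorem shiftAvg_apply (i : Fin 2) (φ : C(Torus, ℝ)) (x : Torus) :
    shiftAvg ε i φ x = ∫ w, φ (x + shiftVec i w) ∂noise ε := rfl

/-- Fourier coefficients of a real continuous function on the torus. -/
noncomputable def torusCoeff (φ : C(Torus, ℝ)) (k : Fin 2 → ℤ) : ℂ :=
  ∫ x, UnitAddTorus.mFourier (-k) x * (φ x : ℂ)

/-- Parseval, after identifying `volume` with the product of the Haar probability measures. -/
theorem hasSum_sq_torusCoeff (φ : C(Torus, ℝ)) :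
    HasSum (fun k => ‖torusCoeff φ k‖ ^ 2) (∫ x, φ x ^ 2) := by
  have hv : (volume : Measure Torus) = Measure.pi fun _ => AddCircle.haarAddCircle := by
    have : (volume : Measure UnitAddCircle) = AddCircle.haarAddCircle := by
      rw [AddCircle.volume_eq_smul_haarAddCircle]; simp
    rw [volume_pi, this]
  let ψ : C(Torus, ℂ) := ⟨fun x => (φ x : ℂ), by fun_prop⟩
  have h := UnitAddTorus.hasSum_sq_mFourierCoeff (ContinuousMap.toLp 2 (Measure.pi fun _ : Fin 2 =>
    (AddCircle.haarAddCircle (T := 1))) ℂ ψ)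
  have h1 : ∀ k, torusCoeff φ k = UnitAddTorus.mFourierCoeff ψ k := by
    intro k
    unfold torusCoeff UnitAddTorus.mFourierCoeff
    rw [hv]
    rfl
  simp only [h1, ← UnitAddTorus.mFourierCoeff_toLp]
  convert! h using 1
  rw [hv]
  refine integral_congr_ae ?_
  have h2 := ContinuousMap.coeFn_toLp (p := 2) (𝕜 := ℂ) (Measure.pi fun _ : Fin 2 =>
    (AddCircle.haarAddCircle (T := 1))) ψ
  filter_upwards [h2] with x hx
  erw [hx]
  simp [ψ]

theorem mFourier_add_apply (k : Fin 2 → ℤ) (x y : Torus) :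
    UnitAddTorus.mFourier k (x + y) = UnitAddTorus.mFourier k x * UnitAddTorus.mFourier k y := by
  simp [UnitAddTorus.mFourier, fourier_apply, AddCircle.toCircle_add, mul_mul_mul_comm]

theorem mFourier_shiftVec (k : Fin 2 → ℤ) (i : Fin 2) (w : ℝ) :
    UnitAddTorus.mFourier k (shiftVec i w) = fourier (k i) (w : UnitAddCircle) := by
  change ∏ j, fourier (k j) (shiftVec i w j) = _
  rw [Finset.prod_eq_single i]
  · simp [shiftVec]
  · intro j _ hj
    rw [shiftVec, Pi.single_eq_of_ne hj, fourier_eval_zero]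
  · simp

/-- By Fubini and translation invariance, each translate multiplies a coefficient by a character,
and the noise averages these characters. -/
theorem torusCoeff_shiftAvg (hε : 0 < ε) (i : Fin 2) (φ : C(Torus, ℝ)) (k : Fin 2 → ℤ) :
    torusCoeff (shiftAvg ε i φ) k = noiseCoeff ε (k i) * torusCoeff φ k := by
  have := isProbabilityMeasure_noise hε
  have hcont : Continuous fun p : Torus × ℝ =>
      UnitAddTorus.mFourier (-k) p.1 * (φ (p.1 + shiftVec i p.2) : ℂ) := by
    have := continuous_shiftVec i
    fun_prop
  have hint : Integrable (Function.uncurry fun (x : Torus) (w : ℝ) =>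
      UnitAddTorus.mFourier (-k) x * (φ (x + shiftVec i w) : ℂ)) (volume.prod (noise ε)) := by
    refine Integrable.of_bound hcont.measurable.aestronglyMeasurable ‖φ‖ (ae_of_all _ fun p => ?_)
    change ‖UnitAddTorus.mFourier (-k) p.1 * (φ (p.1 + shiftVec i p.2) : ℂ)‖ ≤ _
    rw [norm_mul]
    have h1 : ‖UnitAddTorus.mFourier (-k) p.1‖ ≤ 1 :=
      ((UnitAddTorus.mFourier (-k)).norm_coe_le_norm _).trans UnitAddTorus.mFourier_norm.le
    have h2 : ‖(φ (p.1 + shiftVec i p.2) : ℂ)‖ ≤ ‖φ‖ := by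
      rw [Complex.norm_real]; exact φ.norm_coe_le_norm _
    calc _ ≤ 1 * ‖φ‖ := by gcongr
      _ = _ := one_mul _
  calc torusCoeff (shiftAvg ε i φ) k
      = ∫ x, ∫ w, UnitAddTorus.mFourier (-k) x * (φ (x + shiftVec i w) : ℂ) ∂noise ε := by
        refine integral_congr_ae (ae_of_all _ fun x => ?_)
        simp only [shiftAvg_apply]
        rw [← integral_complex_ofReal, ← integral_const_mul]
    _ = ∫ w, (∫ x, UnitAddTorus.mFourier (-k) x * (φ (x + shiftVec i w) : ℂ)) ∂noise ε :=
        integral_integral_swap hint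
    _ = ∫ w, fourier (k i) (w : UnitAddCircle) * torusCoeff φ k ∂noise ε := by
        refine integral_congr_ae (ae_of_all _ fun w => ?_)
        simp only
        rw [torusCoeff, ← integral_add_right_eq_self
          (fun x => UnitAddTorus.mFourier (-k) x * (φ x : ℂ)) (shiftVec i w), ← integral_const_mul]
        refine integral_congr_ae (ae_of_all _ fun x => ?_)
        simp only
        rw [mFourier_add_apply, mFourier_shiftVec, Pi.neg_apply]
        have : fourier (k i) (w : UnitAddCircle) * fourier (-k i) (w : UnitAddCircle) = 1 := by
          rw [← fourier_add, add_neg_cancel, fourier_zero]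
        linear_combination (-(UnitAddTorus.mFourier (-k) x * (φ (x + shiftVec i w) : ℂ))) * this
    _ = noiseCoeff ε (k i) * torusCoeff φ k := integral_mul_const _ _

theorem torusCoeff_zero (φ : C(Torus, ℝ)) : torusCoeff φ 0 = ((∫ x, φ x : ℝ) : ℂ) := by
  rw [torusCoeff, ← integral_complex_ofReal]
  simp [UnitAddTorus.mFourier_zero]

theorem integral_shiftAvg (hε : 0 < ε) (i : Fin 2) (φ : C(Torus, ℝ)) :
    ∫ x, shiftAvg ε i φ x = ∫ x, φ x := by
  have := isProbabilityMeasure_noise hε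
  have h := torusCoeff_shiftAvg hε i φ 0
  rw [torusCoeff_zero, torusCoeff_zero] at h
  have h1 : noiseCoeff ε ((0 : Fin 2 → ℤ) i) = 1 := by simp [noiseCoeff]
  rw [h1, one_mul] at h
  exact_mod_cast h

/-- The averaging operator contracts functions of mean zero. -/
theorem exists_integral_sq_shiftAvg_le (hε : 0 < ε) (hε1 : ε ≤ 1) :
    ∃ c : ℝ, 0 ≤ c ∧ c < 1 ∧ ∀ φ : C(Torus, ℝ), ∫ x, φ x = 0 →
      ∫ x, shiftAvg ε 0 (shiftAvg ε 1 φ) x ^ 2 ≤ c * ∫ x, φ x ^ 2 := by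
  obtain ⟨c, hc0, hc1, hc⟩ := exists_norm_noiseCoeff_le hε hε1
  -- A nonzero frequency has a nonzero component: the average in that direction contributes a factor
  -- `c`, the other at most `1`. Parseval squares the factor.
  refine ⟨c ^ 2, by positivity, by nlinarith, fun φ hφ => ?_⟩
  refine hasSum_le (fun k => ?_) (hasSum_sq_torusCoeff _) ((hasSum_sq_torusCoeff φ).mul_left _)
  rw [torusCoeff_shiftAvg hε, torusCoeff_shiftAvg hε, ← mul_pow]
  gcongr
  rw [norm_mul, norm_mul]
  have hb := norm_noiseCoeff_le_one hε
  by_cases h0 : k 0 = 0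
  · by_cases h1 : k 1 = 0
    · have hk : k = 0 := by ext i; fin_cases i <;> simpa
      rw [hk, torusCoeff_zero, hφ]
      simp
    · calc _ ≤ 1 * (c * ‖torusCoeff φ k‖) := by gcongr; exacts [hb _, hc _ h1]
        _ = _ := one_mul _
  · calc _ ≤ c * (1 * ‖torusCoeff φ k‖) := by gcongr; exacts [hc _ h0, hb _]
      _ = _ := by rw [one_mul]

end Averaging

/-! ### Measurable shears -/

section Shear

theorem measurePreserving_torus_eval (i : Fin 2) :
    MeasurePreserving (fun z : Torus => z i) volume volume :=
  measurePreserving_eval (fun _ => (volume : Measure UnitAddCircle)) i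

/-- The shear in the direction `i` with displacement `a` depending on the coordinate `j`. -/
noncomputable def shear (i j : Fin 2) (a : UnitAddCircle → ℝ) (z : Torus) : Torus :=
  z + shiftVec i (a (z j))

theorem measurable_shear (i j : Fin 2) {a : UnitAddCircle → ℝ} (ha : Measurable a) :
    Measurable (shear i j a) :=
  measurable_id.add ((continuous_shiftVec i).measurable.comp (ha.comp (measurable_pi_apply j)))

theorem shiftVec_apply_of_ne {i j : Fin 2} (h : j ≠ i) (w : ℝ) : shiftVec i w j = 0 :=
  Pi.single_eq_of_ne h _

theorem shiftVec_apply_self (i : Fin 2) (w : ℝ) : shiftVec i w i = (w : UnitAddCircle) :=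
  Pi.single_eq_same _ _

theorem shear_shear (i : Fin 2) {j : Fin 2} (h : j ≠ i) (a b : UnitAddCircle → ℝ) (z : Torus) :
    shear i j b (shear i j a z) = shear i j (a + b) z := by
  simp only [shear, Pi.add_apply, shiftVec_apply_of_ne h, add_zero, add_assoc]
  simp [shiftVec, Pi.single_add]

theorem shear_zero (i j : Fin 2) (z : Torus) : shear i j 0 z = z := by
  simp [shear, shiftVec]

/-- A shear rotates each circle in the direction `i` by an amount constant on that circle. Averaging
over translations in this direction exhibits the rotation without splitting the torus into
coordinates, and needs only measurability of `a`. -/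
theorem measurePreserving_shear {i j : Fin 2} (h : j ≠ i) {a : UnitAddCircle → ℝ}
    (ha : Measurable a) : MeasurePreserving (shear i j a) volume volume := by
  have hs := measurable_shear i j ha
  refine ⟨hs, Measure.ext_of_lintegral _ fun G hG => ?_⟩
  rw [lintegral_map hG hs]
  let s : UnitAddCircle → Torus := fun t => Pi.single i t
  have hsm : Measurable s := (continuous_single i).measurable
  have hsj : ∀ (z : Torus) t, (z + s t) j = z j := fun z t => by
    simp [s, Pi.single_eq_of_ne h]
  have hm1 : Measurable fun p : UnitAddCircle × Torus => G (shear i j a (p.2 + s p.1)) :=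
    hG.comp (hs.comp (measurable_snd.add (hsm.comp measurable_fst)))
  have hm2 : Measurable fun p : UnitAddCircle × Torus => G (p.2 + s p.1) :=
    hG.comp (measurable_snd.add (hsm.comp measurable_fst))
  calc ∫⁻ z, G (shear i j a z)
      = ∫⁻ _ : UnitAddCircle, ∫⁻ z, G (shear i j a z) := by simp
    _ = ∫⁻ t : UnitAddCircle, ∫⁻ z, G (shear i j a (z + s t)) := by
        refine lintegral_congr fun t => ?_
        rw [lintegral_add_right_eq_self fun z => G (shear i j a z)]
    _ = ∫⁻ z, ∫⁻ t : UnitAddCircle, G (shear i j a (z + s t)) :=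
        lintegral_lintegral_swap hm1.aemeasurable
    _ = ∫⁻ z, ∫⁻ t : UnitAddCircle, G (z + s t) := by
        refine lintegral_congr fun z => ?_
        rw [← lintegral_add_right_eq_self (fun t => G (z + s t)) ((a (z j) : ℝ) : UnitAddCircle)]
        refine lintegral_congr fun t => ?_
        rw [shear, hsj]
        simp only [s, shiftVec, Pi.single_add, add_assoc]
    _ = ∫⁻ t : UnitAddCircle, ∫⁻ z, G (z + s t) :=
        (lintegral_lintegral_swap hm2.aemeasurable).symm
    _ = ∫⁻ z, G z := by
        simp only [lintegral_add_right_eq_self, lintegral_const, measure_univ, mul_one]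

/-- Two successive noises, in the two coordinate directions, have a bounded joint density. -/
theorem lintegral_lintegral_noise_le {ε : ℝ} (hε1 : ε ≤ 1) {G : Torus → ℝ≥0∞}
    (hG : Measurable G) (y : Torus) :
    ∫⁻ w, ∫⁻ w', G (y + shiftVec 0 w + shiftVec 1 w') ∂noise ε ∂noise ε ≤
      ENNReal.ofReal ε⁻¹ ^ 2 * ∫⁻ z, G z := by
  let u : UnitAddCircle → UnitAddCircle → Torus := fun a b => ![a, b]
  have hu : ∀ w w' : ℝ, y + shiftVec 0 w + shiftVec 1 w' = u (y 0 + w) (y 1 + w') := by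
    intro w w'
    ext i
    fin_cases i
    · simp [u, shiftVec]
    · simp [u, shiftVec]
  simp only [hu]
  calc ∫⁻ w : ℝ, ∫⁻ w' : ℝ, G (u (y 0 + w) (y 1 + w')) ∂noise ε ∂noise ε
      ≤ ∫⁻ w : ℝ, (ENNReal.ofReal ε⁻¹ * ∫⁻ b, G (u (y 0 + w) b)) ∂noise ε := by
        exact lintegral_mono fun w => lintegral_noise_le hε1 (G := fun b => G (u (y 0 + w) b)) (y 1)
    _ ≤ ENNReal.ofReal ε⁻¹ * ∫⁻ a, ENNReal.ofReal ε⁻¹ * ∫⁻ b, G (u a b) :=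
        lintegral_noise_le hε1 (G := fun a => ENNReal.ofReal ε⁻¹ * ∫⁻ b, G (u a b)) (y 0)
    _ = ENNReal.ofReal ε⁻¹ ^ 2 * ∫⁻ a, ∫⁻ b, G (u a b) := by
        rw [lintegral_const_mul' _ _ ENNReal.ofReal_ne_top, ← mul_assoc, sq]
    _ = ENNReal.ofReal ε⁻¹ ^ 2 * ∫⁻ z, G z := by
        congr 1
        have h1 := (volume_preserving_finTwoArrow UnitAddCircle).symm
        rw [← h1.lintegral_comp hG, Measure.volume_eq_prod]
        exact (lintegral_prod _ (hG.comp h1.measurable).aemeasurable).symm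

end Shear

/-! ### The random perturbation as a chain in two half-steps -/

section Chain

variable {ε : ℝ} {f : Torus → Torus} {S : Type*}

/-- One step of the random chain: the first half applies `f` and moves in the direction `0`, the
second half moves in the direction `1`. -/
noncomputable def chainStep (f : Torus → Torus) (e : Torus × Bool) (w : ℝ) : Torus × Bool :=
  bif e.2 then (e.1 + shiftVec 1 w, false) else (f e.1 + shiftVec 0 w, true)

/-- The site whose noise is used at a given state. -/
def chainSite (f : Torus → Torus) (s : UnitAddCircle → S) (e : Torus × Bool) : Bool × S :=
  (e.2, bif e.2 then s (e.1 0) else s (f e.1 1))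

theorem measurable_chainStep (hf : Measurable f) :
    Measurable fun p : (Torus × Bool) × ℝ => chainStep f p.1 p.2 := by
  have hs := fun i => (continuous_shiftVec i).measurable
  have h : Measurable fun q : (Torus × ℝ) × Bool => chainStep f (q.1.1, q.2) q.1.2 := by
    refine measurable_from_prod_countable_left fun b => ?_
    cases b
    · exact ((hf.comp measurable_fst).add ((hs 0).comp measurable_snd)).prodMk measurable_const
    · exact (measurable_fst.add ((hs 1).comp measurable_snd)).prodMk measurable_const
  exact h.comp (((measurable_fst.comp measurable_fst).prodMk measurable_snd).prodMk
    (measurable_snd.comp measurable_fst))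

theorem measurable_chainSite [MeasurableSpace S] (hf : Measurable f) {s : UnitAddCircle → S}
    (hs : Measurable s) : Measurable (chainSite f s) := by
  refine measurable_from_prod_countable_left fun b => ?_
  cases b
  · exact measurable_const.prodMk (hs.comp ((measurable_pi_apply 1).comp hf))
  · exact measurable_const.prodMk (hs.comp (measurable_pi_apply 0))

/-- The perturbation of `f` by two shears. -/
noncomputable def shearPerturb (f : Torus → Torus) (a b : UnitAddCircle → ℝ) (x : Torus) : Torus :=
  shear 1 0 b (shear 0 1 a (f x))

theorem measurePreserving_shearPerturb (hf : MeasurePreserving f volume volume)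
    {a b : UnitAddCircle → ℝ} (ha : Measurable a) (hb : Measurable b) :
    MeasurePreserving (shearPerturb f a b) volume volume :=
  (measurePreserving_shear (by decide) hb).comp ((measurePreserving_shear (by decide) ha).comp hf)

/-- Each half-step reads a single noise variable, as the coupling lemma requires; two of them make
one iterate of the perturbed map. -/
theorem iterate_siteStep_chainStep (s : UnitAddCircle → S) (θ : Bool × S → ℝ) (n : ℕ) (x : Torus) :
    (siteStep (chainStep f) (chainSite f s) θ)^[2 * n] (x, false) =
      ((shearPerturb f (fun t => θ (false, s t)) (fun t => θ (true, s t)))^[n] x, false) := by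
  induction n with
  | zero => rfl
  | succ n ih =>
    rw [Nat.mul_succ, Function.iterate_succ_apply', Function.iterate_succ_apply', ih,
      Function.iterate_succ_apply']
    rfl

theorem noiseOp_le_of_le (hε : 0 < ε) {F : Torus × Bool → ℝ≥0∞} {κ : ℝ≥0∞} (h : ∀ e, F e ≤ κ)
    (n : ℕ) (e : Torus × Bool) : (noiseOp (noise ε) (chainStep f))^[n] F e ≤ κ := by
  have := isProbabilityMeasure_noise hε
  induction n generalizing e with
  | zero => exact h e
  | succ n ih =>
    rw [Function.iterate_succ_apply']
    calc _ ≤ ∫⁻ _, κ ∂noise ε := lintegral_mono fun w => ih _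
      _ = κ := by simp

/-- The last two noises, from an arbitrary intermediate state, already spread the law with density
at most `ε⁻¹ ^ 2`, so a cell of measure `δ` is rarely hit. A return after one half-step is
impossible, since the Boolean flips. -/
theorem noiseOp_return_le [DecidableEq S] [MeasurableSpace S] [MeasurableSingletonClass S]
    (hε : 0 < ε) (hε1 : ε ≤ 1)
    (hf : MeasurePreserving f volume volume) {s : UnitAddCircle → S} (hs : Measurable s) {δ : ℝ≥0∞}
    (hδ : ∀ i, volume (s ⁻¹' {i}) ≤ δ) (e : Torus × Bool) (k : ℕ) :
    (noiseOp (noise ε) (chainStep f))^[k + 1]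
      ({e' | chainSite f s e' = chainSite f s e}.indicator 1) e ≤
      ENNReal.ofReal ε⁻¹ ^ 2 * δ := by
  have := isProbabilityMeasure_noise hε
  rcases k with _ | k
  · have h0 : ∀ w, {e' | chainSite f s e' = chainSite f s e}.indicator (1 : Torus × Bool → ℝ≥0∞)
        (chainStep f e w) = 0 := by
      intro w
      refine Set.indicator_of_notMem (fun h => ?_) _
      have := congrArg Prod.fst h
      rcases e with ⟨x, b⟩
      cases b <;> simp [chainSite, chainStep] at this
    simp [noiseOp, h0]
  · rw [add_assoc, Function.iterate_add_apply]
    refine noiseOp_le_of_le hε (fun e' => ?_) k e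
    obtain ⟨b, i⟩ := chainSite f s e
    obtain ⟨x, b'⟩ := e'
    change ∫⁻ w, ∫⁻ w', _ ∂noise ε ∂noise ε ≤ _
    have hC : 1 ≤ ENNReal.ofReal ε⁻¹ := by
      rw [← ENNReal.ofReal_one]
      exact ENNReal.ofReal_le_ofReal ((one_le_inv₀ hε).2 hε1)
    by_cases hbb : b' = b
    swap
    · have h0 : ∀ w w', {e' | chainSite f s e' = (b, i)}.indicator (1 : Torus × Bool → ℝ≥0∞)
          (chainStep f (chainStep f (x, b') w) w') = 0 := by
        intro w w'
        refine Set.indicator_of_notMem (fun h => hbb ?_) _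
        have := congrArg Prod.fst h
        cases b' <;> simpa [chainSite, chainStep] using this
      simp [h0]
    subst hbb
    have hsi := hs (measurableSet_singleton i)
    cases b'
    -- The next site depends on `f z`, so the set to avoid is a pullback by `f`, and both noises are
    -- needed to compare with Lebesgue measure.
    · let A : Set Torus := {z | s (f z 1) = i}
      have hA : MeasurableSet A := hf.measurable ((measurable_pi_apply (X := fun _ : Fin 2 => UnitAddCircle) 1) hsi)
      have hAv : volume A ≤ δ := by
        have h1 : A = f ⁻¹' (Function.eval 1 ⁻¹' (s ⁻¹' {i})) := rfl
        have h2 := measurePreserving_torus_eval 1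
        rw [h1, hf.measure_preimage (h2.measurable hsi).nullMeasurableSet]
        exact (h2.measure_preimage hsi.nullMeasurableSet).le.trans (hδ i)
      calc _ = ∫⁻ w, ∫⁻ w', A.indicator 1 (f x + shiftVec 0 w + shiftVec 1 w')
              ∂noise ε ∂noise ε := by
            refine lintegral_congr fun w => lintegral_congr fun w' => ?_
            simp [Set.indicator_apply, A, chainSite, chainStep]
        _ ≤ ENNReal.ofReal ε⁻¹ ^ 2 * ∫⁻ z, A.indicator 1 z :=
            lintegral_lintegral_noise_le hε1 (measurable_one.indicator hA) _
        _ ≤ _ := by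
            rw [lintegral_indicator_one hA]
            gcongr
    -- Here the site is read from coordinate `0`, which the last noise alone smears; the spare
    -- factor `ε⁻¹ ≥ 1` is given away.
    · calc _ = ∫⁻ w, ∫⁻ w', (s ⁻¹' {i}).indicator 1 ((f (x + shiftVec 1 w)) 0 +
              (w' : UnitAddCircle)) ∂noise ε ∂noise ε := by
            refine lintegral_congr fun w => lintegral_congr fun w' => ?_
            by_cases h : s (f (x + shiftVec 1 w) 0 + (w' : UnitAddCircle)) = i <;>
              simp [Set.indicator, chainSite, chainStep, shiftVec_apply_self, h]
        _ ≤ ∫⁻ _, (ENNReal.ofReal ε⁻¹ * ∫⁻ y, (s ⁻¹' {i}).indicator 1 y) ∂noise ε :=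
            lintegral_mono fun w =>
              lintegral_noise_le hε1 (G := (s ⁻¹' {i}).indicator 1) _
        _ ≤ ENNReal.ofReal ε⁻¹ * δ := by
            rw [lintegral_const, measure_univ, mul_one, lintegral_indicator_one hsi]
            gcongr
            exact hδ i
        _ ≤ _ := by
            gcongr
            rw [sq]
            exact le_mul_of_one_le_left' hC

/-- The Markov operator of the random perturbation of `f`. -/
noncomputable def perturbOp (ε : ℝ) (f : C(Torus, Torus)) (φ : C(Torus, ℝ)) : C(Torus, ℝ) :=
  (shiftAvg ε 0 (shiftAvg ε 1 φ)).comp f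

theorem shiftAvg_nonneg {φ : C(Torus, ℝ)} (h : ∀ x, 0 ≤ φ x) (i : Fin 2) (x : Torus) :
    0 ≤ shiftAvg ε i φ x := integral_nonneg fun _ => h _

theorem ofReal_shiftAvg {φ : C(Torus, ℝ)} (h : ∀ x, 0 ≤ φ x) (i : Fin 2) (x : Torus) :
    ENNReal.ofReal (shiftAvg ε i φ x) =
      ∫⁻ w, ENNReal.ofReal (φ (x + shiftVec i w)) ∂noise ε :=
  ofReal_integral_eq_lintegral_ofReal
    (integrable_of_continuousMap φ (continuous_const.add (continuous_shiftVec i)).measurable)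
    (ae_of_all _ fun _ => h _)

/-- Identifies the fresh-noise chain, observed at even times, with the operator to which the
spectral gap applies. -/
theorem iterate_noiseOp_chainStep (f : C(Torus, Torus)) (n : ℕ) :
    ∀ (φ : C(Torus, ℝ)), (∀ x, 0 ≤ φ x) → ∀ F : Torus × Bool → ℝ≥0∞,
      (∀ x, F (x, false) = ENNReal.ofReal (φ x)) → ∀ x,
      (noiseOp (noise ε) (chainStep f))^[2 * n] F (x, false) =
        ENNReal.ofReal ((perturbOp ε f)^[n] φ x) := by
  induction n with
  | zero => intro φ _ F hF x; exact hF x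
  | succ n ih =>
    intro φ hφ F hF x
    rw [Nat.mul_succ, Function.iterate_add_apply,
      Function.iterate_succ_apply (perturbOp ε f)]
    refine ih (perturbOp ε f φ) (fun y => shiftAvg_nonneg (shiftAvg_nonneg hφ 1) 0 _) _ (fun y => ?_) x
    change ∫⁻ w, ∫⁻ w', _ ∂noise ε ∂noise ε = ENNReal.ofReal (shiftAvg ε 0 (shiftAvg ε 1 φ) (f y))
    rw [ofReal_shiftAvg (shiftAvg_nonneg hφ 1)]
    refine lintegral_congr fun w => ?_
    rw [ofReal_shiftAvg hφ]
    exact lintegral_congr fun w' => hF _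

/-- In average over the environment, an iterate of the random perturbation of `f` acts on
observables as the Markov operator, up to a small error. -/
theorem lintegral_iterate_shearPerturb_le [Fintype S] [DecidableEq S] [MeasurableSpace S]
    [DiscreteMeasurableSpace S] (hε : 0 < ε) (hε1 : ε ≤ 1) {f : C(Torus, Torus)}
    (hf : MeasurePreserving f volume volume) {s : UnitAddCircle → S} (hs : Measurable s) {δ : ℝ≥0∞}
    (hδ : ∀ i, volume (s ⁻¹' {i}) ≤ δ) {φ : C(Torus, ℝ)} (h0 : ∀ x, 0 ≤ φ x) (h1 : ∀ x, φ x ≤ 1)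
    (n : ℕ) (x : Torus) :
    ∫⁻ θ : Bool × S → ℝ, ENNReal.ofReal (φ ((shearPerturb f (fun t => θ (false, s t))
        (fun t => θ (true, s t)))^[n] x)) ∂Measure.pi (fun _ => noise ε) ≤
      ENNReal.ofReal ((perturbOp ε f)^[n] φ x) +
        (3 ^ (2 * n) : ℕ) * (ENNReal.ofReal ε⁻¹ ^ 2 * δ) := by
  have := isProbabilityMeasure_noise hε
  have h := lintegral_iterate_siteStep_le (noise ε) (measurable_chainStep hf.measurable)
    (measurable_chainSite hf.measurable hs) (noiseOp_return_le hε hε1 hf hs hδ) (2 * n)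
    (fun e => ENNReal.ofReal (φ e.1))
    (φ.continuous.measurable.comp measurable_fst).ennreal_ofReal
    (fun e => ENNReal.ofReal_le_one.2 (h1 _)) (x, false)
  rw [iterate_noiseOp_chainStep f n φ h0 _ fun _ => rfl] at h
  simpa only [iterate_siteStep_chainStep] using h

theorem measurable_iterate_shearPerturb [Fintype S] [DecidableEq S] [MeasurableSpace S]
    [DiscreteMeasurableSpace S] (hf : Measurable f) {s : UnitAddCircle → S} (hs : Measurable s)
    (n : ℕ) :
    Measurable fun p : (Bool × S → ℝ) × Torus => (shearPerturb f (fun t => p.1 (false, s t))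
        (fun t => p.1 (true, s t)))^[n] p.2 := by
  have h := (measurable_fst.comp (measurable_iterate_siteStep (measurable_chainStep hf)
    (measurable_chainSite hf hs) (2 * n))).comp
    ((measurable_fst (α := Bool × S → ℝ) (β := Torus)).prodMk
      ((measurable_snd (α := Bool × S → ℝ) (β := Torus)).prodMk (measurable_const (a := false))))
  simpa only [Function.comp_def, iterate_siteStep_chainStep] using h

end Chain

/-! ### Decay of variance and correlations -/

section Decay

variable {ε : ℝ}

theorem integrable_continuousMap (φ : C(Torus, ℝ)) : Integrable φ volume :=
  integrable_of_continuousMap φ measurable_id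

theorem integral_comp_measurePreserving {g : Torus → Torus} (hg : MeasurePreserving g volume volume)
    {u : Torus → ℝ} (hu : Measurable u) : ∫ x, u (g x) = ∫ x, u x := by
  conv_rhs => rw [← hg.map_eq]
  rw [integral_map hg.measurable.aemeasurable hu.aestronglyMeasurable]

theorem integral_perturbOp (hε : 0 < ε) {f : C(Torus, Torus)}
    (hf : MeasurePreserving f volume volume) (φ : C(Torus, ℝ)) :
    ∫ x, perturbOp ε f φ x = ∫ x, φ x := by
  rw [← integral_shiftAvg hε 1 φ, ← integral_shiftAvg hε 0 (shiftAvg ε 1 φ)]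
  exact integral_comp_measurePreserving hf
    (shiftAvg ε 0 (shiftAvg ε 1 φ)).continuous.measurable

theorem integral_iterate_perturbOp (hε : 0 < ε) {f : C(Torus, Torus)}
    (hf : MeasurePreserving f volume volume) (φ : C(Torus, ℝ)) (n : ℕ) :
    ∫ x, (perturbOp ε f)^[n] φ x = ∫ x, φ x := by
  induction n with
  | zero => rfl
  | succ n ih => rw [Function.iterate_succ_apply', integral_perturbOp hε hf, ih]

theorem shiftAvg_sub_const (hε : 0 < ε) (i : Fin 2) (φ : C(Torus, ℝ)) (m : ℝ) :
    shiftAvg ε i (φ - ContinuousMap.const _ m) = shiftAvg ε i φ - ContinuousMap.const _ m := by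
  have := isProbabilityMeasure_noise hε
  ext x
  have h := integral_sub (μ := noise ε) (integrable_of_continuousMap φ
    (u := fun w => x + shiftVec i w) (continuous_const.add (continuous_shiftVec i)).measurable)
    (integrable_const m)
  simpa [shiftAvg_apply] using h

/-- The Markov operator of the perturbation contracts the variance. -/
theorem exists_variance_perturbOp_le (hε : 0 < ε) (hε1 : ε ≤ 1) :
    ∃ c : ℝ, 0 ≤ c ∧ c < 1 ∧ ∀ f : C(Torus, Torus), MeasurePreserving f volume volume →
      ∀ (φ : C(Torus, ℝ)) (n : ℕ),
      ∫ x, ((perturbOp ε f)^[n] φ x - ∫ y, φ y) ^ 2 ≤ c ^ n * ∫ x, (φ x - ∫ y, φ y) ^ 2 := by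
  obtain ⟨c, hc0, hc1, hc⟩ := exists_integral_sq_shiftAvg_le hε hε1
  refine ⟨c, hc0, hc1, fun f hf φ n => ?_⟩
  have step : ∀ φ : C(Torus, ℝ), ∫ x, (perturbOp ε f φ x - ∫ y, φ y) ^ 2 ≤
      c * ∫ x, (φ x - ∫ y, φ y) ^ 2 := by
    intro φ
    set m := ∫ y, φ y
    have h0 : ∫ x, (φ - ContinuousMap.const Torus m : C(Torus, ℝ)) x = 0 := by
      simp only [ContinuousMap.sub_apply, ContinuousMap.const_apply]
      rw [integral_sub (integrable_continuousMap φ) (integrable_const m)]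
      simp [m]
    have h1 := hc _ h0
    rw [shiftAvg_sub_const hε, shiftAvg_sub_const hε] at h1
    refine le_trans (le_of_eq ?_) h1
    exact integral_comp_measurePreserving hf ((ContinuousMap.continuous (shiftAvg ε 0
      (shiftAvg ε 1 φ) - ContinuousMap.const _ m)).pow 2).measurable
  induction n with
  | zero => simp
  | succ n ih =>
    have h := step ((perturbOp ε f)^[n] φ)
    rw [integral_iterate_perturbOp hε hf] at h
    rw [Function.iterate_succ_apply']
    refine h.trans ?_
    rw [pow_succ', mul_assoc]
    gcongr

theorem integral_mem_unit {φ : C(Torus, ℝ)} (h0 : ∀ x, 0 ≤ φ x) (h1 : ∀ x, φ x ≤ 1) :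
    0 ≤ ∫ x, φ x ∧ ∫ x, φ x ≤ 1 := by
  refine ⟨integral_nonneg h0, ?_⟩
  calc ∫ x, φ x ≤ ∫ _ : Torus, (1 : ℝ) :=
        integral_mono (integrable_continuousMap φ) (integrable_const 1) h1
    _ = 1 := by simp

/-- Replacing the iterate by its mean costs its `L¹` distance to that mean, controlled through `|t|
≤ η / 2 + t ^ 2 / (2 η)` in place of Cauchy–Schwarz. -/
theorem integral_mul_iterate_perturbOp_le {f : C(Torus, Torus)} {φ : C(Torus, ℝ)} (h0 : ∀ x, 0 ≤ φ x)
    (h1 : ∀ x, φ x ≤ 1) {n : ℕ} {η : ℝ} (hη : 0 < η)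
    (h : ∫ x, ((perturbOp ε f)^[n] φ x - ∫ y, φ y) ^ 2 ≤ η ^ 2) :
    ∫ x, φ x * (perturbOp ε f)^[n] φ x ≤ (∫ x, φ x) ^ 2 + η := by
  set m := ∫ y, φ y
  set ψ := (perturbOp ε f)^[n] φ
  have hle : ∀ x, φ x * ψ x ≤ m * φ x + (η / 2 + (2 * η)⁻¹ * (ψ x - m) ^ 2) := by
    intro x
    have h2 : φ x * (ψ x - m) ≤ |ψ x - m| := by
      calc _ ≤ φ x * |ψ x - m| := by gcongr; exacts [h0 x, le_abs_self _]
        _ ≤ 1 * |ψ x - m| := by gcongr; exact h1 x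
        _ = _ := one_mul _
    have h3 : |ψ x - m| ≤ η / 2 + (2 * η)⁻¹ * (ψ x - m) ^ 2 := by
      rw [← sq_abs (ψ x - m)]
      have : η / 2 + (2 * η)⁻¹ * |ψ x - m| ^ 2 - |ψ x - m| =
          (2 * η)⁻¹ * (|ψ x - m| - η) ^ 2 := by field_simp; ring
      have h4 : 0 ≤ (2 * η)⁻¹ * (|ψ x - m| - η) ^ 2 := by positivity
      linarith
    linarith
  have hi1 : Integrable (fun x => (ψ x - m) ^ 2) (volume : Measure Torus) :=
    integrable_continuousMap ((ψ - ContinuousMap.const _ m) ^ 2)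
  calc ∫ x, φ x * ψ x
      ≤ ∫ x, (m * φ x + (η / 2 + (2 * η)⁻¹ * (ψ x - m) ^ 2)) := by
        refine integral_mono (integrable_continuousMap (φ * ψ)) ?_ hle
        exact ((integrable_continuousMap φ).const_mul m).add
          ((integrable_const _).add (hi1.const_mul _))
    _ = m * m + (η / 2 + (2 * η)⁻¹ * ∫ x, (ψ x - m) ^ 2) := by
        rw [integral_add (g := fun x => η / 2 + (2 * η)⁻¹ * (ψ x - m) ^ 2)
          ((integrable_continuousMap φ).const_mul m)
          ((integrable_const _).add (hi1.const_mul _)), integral_const_mul,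
          integral_add (integrable_const _) (hi1.const_mul _), integral_const_mul]
        simp [m]
    _ ≤ m * m + (η / 2 + (2 * η)⁻¹ * η ^ 2) := by gcongr
    _ = m ^ 2 + η := by field_simp; ring

end Decay

/-! ### Second moment argument over the random displacements -/

/-- The circle is a union of finitely many measurable sets of small measure. -/
theorem exists_measurable_fin_fiber_le {δ : ℝ≥0∞} (hδ : δ ≠ 0) :
    ∃ (N : ℕ) (s : UnitAddCircle → Fin N), Measurable s ∧ ∀ i, volume (s ⁻¹' {i}) ≤ δ := by
  obtain ⟨N, hN⟩ := ENNReal.exists_inv_nat_lt hδ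
  have hN0 : N ≠ 0 := by
    rintro rfl
    simp at hN
  have := NeZero.mk hN0
  have hNpos : (0 : ℝ) < N := by exact_mod_cast Nat.pos_of_ne_zero hN0
  let r : UnitAddCircle → ℝ := fun y => (AddCircle.equivIco 1 0 y : ℝ)
  have hr : Measurable r := measurable_subtype_coe.comp (AddCircle.measurableEquivIco 1 0).measurable
  have hr0 : ∀ y, 0 ≤ r y := fun y => (AddCircle.equivIco 1 0 y).2.1
  have hr1 : ∀ y, r y < 1 := fun y => by simpa using (AddCircle.equivIco 1 0 y).2.2
  have hrc : ∀ y, (r y : UnitAddCircle) = y := fun y => (AddCircle.equivIco 1 0).symm_apply_apply y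
  refine ⟨N, fun y => Fin.ofNat N ⌊N * r y⌋₊,
    (measurable_from_top (f := Fin.ofNat N)).comp (Nat.measurable_floor.comp (hr.const_mul _)), fun i => ?_⟩
  -- The cells are the arcs `[i/N, (i+1)/N)`, enclosed in balls of radius `1/(2N)` about their
  -- midpoints.
  have hsub : (fun y => Fin.ofNat N ⌊N * r y⌋₊) ⁻¹' {i} ⊆
      Metric.closedBall (((i + 1 / 2) / N : ℝ) : UnitAddCircle) (1 / (2 * N)) := by
    intro y hy
    have h1 : ⌊N * r y⌋₊ < N := (Nat.floor_lt (by have := hr0 y; positivity)).2 (by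
      have := hr1 y; nlinarith)
    have h2 : ⌊N * r y⌋₊ = (i : ℕ) := by
      have := congrArg Fin.val (Set.mem_singleton_iff.1 hy)
      simpa [Fin.ofNat, Nat.mod_eq_of_lt h1] using this
    have h3 : (i : ℝ) ≤ N * r y := by
      rw [← h2]; exact Nat.floor_le (by have := hr0 y; positivity)
    have h4 : N * r y < i + 1 := by
      rw [← h2]; exact Nat.lt_floor_add_one _
    rw [Metric.mem_closedBall, dist_eq_norm]
    conv_lhs => rw [← hrc y, ← AddCircle.coe_sub]
    refine QuotientAddGroup.norm_mk_le_norm.trans ?_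
    rw [Real.norm_eq_abs, abs_le]
    have h5 : ((i + 1 / 2) / N : ℝ) * N = i + 1 / 2 := by field_simp
    have h6 : 1 / (2 * (N : ℝ)) * N = 1 / 2 := by field_simp
    constructor <;> refine le_of_mul_le_mul_right ?_ hNpos
    · linarith
    · linarith
  refine (measure_mono hsub).trans ?_
  rw [AddCircle.volume_closedBall]
  refine le_trans ?_ hN.le
  rw [← ENNReal.ofReal_natCast, ← ENNReal.ofReal_inv_of_pos hNpos]
  refine ENNReal.ofReal_le_ofReal ((min_le_right _ _).trans (le_of_eq ?_))
  field_simp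

/-- The average of `φ` over the first `n` points of the orbit of `x` under `g^D`. -/
noncomputable def orbitAvg (φ : Torus → ℝ) (g : Torus → Torus) (D n : ℕ) (x : Torus) : ℝ :=
  (∑ k ∈ Finset.range n, φ (g^[D * k] x)) / n

/-- The mean square deviation of the averages of `φ` along the orbits of `g^D`. -/
noncomputable def orbitDev (φ : Torus → ℝ) (g : Torus → Torus) (D n : ℕ) : ℝ :=
  ∫ x, (orbitAvg φ g D n x - ∫ y, φ y) ^ 2

theorem measurable_orbitAvg {φ : Torus → ℝ} (hφ : Measurable φ) {g : Torus → Torus}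
    (hg : Measurable g) (D n : ℕ) : Measurable (orbitAvg φ g D n) :=
  (Finset.measurable_fun_sum _ fun _ _ => hφ.comp (hg.iterate _)).div_const _

theorem orbitAvg_mem_unit {φ : C(Torus, ℝ)} (h0 : ∀ x, 0 ≤ φ x) (h1 : ∀ x, φ x ≤ 1)
    (g : Torus → Torus) (D n : ℕ) (x : Torus) :
    0 ≤ orbitAvg φ g D n x ∧ orbitAvg φ g D n x ≤ 1 := by
  refine ⟨div_nonneg (Finset.sum_nonneg fun _ _ => h0 _) n.cast_nonneg, ?_⟩
  refine div_le_one_of_le₀ ?_ n.cast_nonneg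
  calc _ ≤ ∑ _ ∈ Finset.range n, (1 : ℝ) := Finset.sum_le_sum fun _ _ => h1 _
    _ = n := by simp

theorem integral_orbitAvg (φ : C(Torus, ℝ)) {g : Torus → Torus}
    (hg : MeasurePreserving g volume volume) (D : ℕ) {n : ℕ} (hn : n ≠ 0) :
    ∫ x, orbitAvg φ g D n x = ∫ x, φ x := by
  have hn' : (n : ℝ) ≠ 0 := Nat.cast_ne_zero.2 hn
  simp only [orbitAvg]
  rw [integral_div, integral_finsetSum _ fun k _ =>
    integrable_of_continuousMap φ (hg.iterate _).measurable]
  simp only [fun k => integral_comp_measurePreserving (hg.iterate (D * k))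
    φ.continuous.measurable, Finset.sum_const, Finset.card_range, nsmul_eq_mul]
  field_simp

theorem orbitDev_eq {φ : C(Torus, ℝ)} (h0 : ∀ x, 0 ≤ φ x) (h1 : ∀ x, φ x ≤ 1)
    {g : Torus → Torus} (hg : MeasurePreserving g volume volume) (D : ℕ) {n : ℕ} (hn : n ≠ 0) :
    orbitDev φ g D n = (∫ x, orbitAvg φ g D n x ^ 2) - (∫ x, φ x) ^ 2 := by
  set m := ∫ x, φ x
  have hm := measurable_orbitAvg φ.continuous.measurable hg.measurable D n
  have hu := orbitAvg_mem_unit h0 h1 g D n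
  have hi1 : Integrable (orbitAvg φ g D n) (volume : Measure Torus) :=
    Integrable.of_bound hm.aestronglyMeasurable 1 (ae_of_all _ fun x => by
      rw [Real.norm_eq_abs, abs_of_nonneg (hu x).1]; exact (hu x).2)
  have hi2 : Integrable (fun x => orbitAvg φ g D n x ^ 2) (volume : Measure Torus) :=
    Integrable.of_bound (hm.pow_const 2).aestronglyMeasurable 1 (ae_of_all _ fun x => by
      rw [Real.norm_eq_abs, abs_of_nonneg (by positivity)]
      exact pow_le_one₀ (hu x).1 (hu x).2)
  calc orbitDev φ g D n
      = ∫ x, (orbitAvg φ g D n x ^ 2 - (2 * m * orbitAvg φ g D n x - m ^ 2)) := by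
        refine integral_congr_ae (ae_of_all _ fun x => ?_)
        simp only [m]; ring
    _ = (∫ x, orbitAvg φ g D n x ^ 2) - (2 * m * m - m ^ 2) := by
        rw [integral_sub (g := fun x => 2 * m * orbitAvg φ g D n x - m ^ 2) hi2 ((hi1.const_mul _).sub (integrable_const _)),
          integral_sub (hi1.const_mul _) (integrable_const _), integral_const_mul,
          integral_orbitAvg φ hg D hn]
        simp [m]
    _ = _ := by ring

/-- Bound for the correlations between two times of a random family of measure preserving maps. -/
theorem lintegral_correlation_le {Θ : Type*} [MeasurableSpace Θ] {P : Measure Θ}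
    [IsProbabilityMeasure P] {φ : C(Torus, ℝ)} {g : Θ → Torus → Torus}
    (hg : ∀ θ, MeasurePreserving (g θ) volume volume)
    (hgm : ∀ n, Measurable fun p : Θ × Torus => (g p.1)^[n] p.2)
    {B : ℝ≥0∞} {D n : ℕ}
    (hB : ∀ e, D ≤ e → e ≤ D * n → ∫⁻ x, ENNReal.ofReal (φ x) *
      ∫⁻ θ, ENNReal.ofReal (φ ((g θ)^[e] x)) ∂P ≤ B) {k l : ℕ} (hkl : k < l) (hl : l < n) :
    ∫⁻ θ, (∫⁻ x, ENNReal.ofReal (φ ((g θ)^[D * k] x)) *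
      ENNReal.ofReal (φ ((g θ)^[D * l] x))) ∂P
      ≤ B := by
  set e := D * (l - k)
  have hel : D * l = e + D * k := by
    rw [← mul_add, Nat.sub_add_cancel hkl.le]
  have hφ : Measurable fun x => ENNReal.ofReal (φ x) := φ.continuous.measurable.ennreal_ofReal
  have hm : Measurable fun p : Θ × Torus =>
      ENNReal.ofReal (φ p.2) * ENNReal.ofReal (φ ((g p.1)^[e] p.2)) :=
    (hφ.comp measurable_snd).mul (hφ.comp (hgm e))
  calc ∫⁻ θ, (∫⁻ x, ENNReal.ofReal (φ ((g θ)^[D * k] x)) *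
        ENNReal.ofReal (φ ((g θ)^[D * l] x))) ∂P
      = ∫⁻ θ, (∫⁻ x, ENNReal.ofReal (φ x) * ENNReal.ofReal (φ ((g θ)^[e] x))) ∂P := by
        -- Invariance of Lebesgue measure under `(g θ)^[D * k]` removes the common initial time,
        -- leaving a gap that is a multiple of `D`.
        refine lintegral_congr fun θ => ?_
        rw [← ((hg θ).iterate (D * k)).lintegral_comp
          (f := fun x => ENNReal.ofReal (φ x) * ENNReal.ofReal (φ ((g θ)^[e] x))) (hφ.mul (hφ.comp ((hg θ).iterate e).measurable))]
        simp only [hel, Function.iterate_add_apply]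
    _ = ∫⁻ x, ∫⁻ θ, ENNReal.ofReal (φ x) * ENNReal.ofReal (φ ((g θ)^[e] x)) ∂P :=
        lintegral_lintegral_swap hm.aemeasurable
    _ = ∫⁻ x, ENNReal.ofReal (φ x) * ∫⁻ θ, ENNReal.ofReal (φ ((g θ)^[e] x)) ∂P := by
        simp only [lintegral_const_mul' _ _ ENNReal.ofReal_ne_top]
    _ ≤ B := hB e (Nat.le_mul_of_pos_right _ (Nat.sub_pos_of_lt hkl))
        (Nat.mul_le_mul_left _ ((Nat.sub_le _ _).trans hl.le))

/-- A random family of measure preserving maps with small correlations contains maps whose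
averages deviate little from the mean. -/
theorem exists_orbitDev_le {Θ : Type*} [MeasurableSpace Θ] {P : Measure Θ}
    [IsProbabilityMeasure P] {φ : C(Torus, ℝ)} (h0 : ∀ x, 0 ≤ φ x) (h1 : ∀ x, φ x ≤ 1)
    {g : Θ → Torus → Torus} (hg : ∀ θ, MeasurePreserving (g θ) volume volume)
    (hgm : ∀ n, Measurable fun p : Θ × Torus => (g p.1)^[n] p.2)
    {b : ℝ} (hb : 0 ≤ b) {D n : ℕ} (hn : n ≠ 0)
    (hB : ∀ e, D ≤ e → e ≤ D * n → ∫⁻ x, ENNReal.ofReal (φ x) *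
      ∫⁻ θ, ENNReal.ofReal (φ ((g θ)^[e] x)) ∂P ≤ ENNReal.ofReal b)
    {N : Set Θ} (hN : P N = 0) :
    ∃ θ ∉ N, orbitDev φ (g θ) D n ≤ 1 / n + b - (∫ x, φ x) ^ 2 := by
  have hφ : Measurable fun x => ENNReal.ofReal (φ x) := φ.continuous.measurable.ennreal_ofReal
  set u : Θ → ℕ → Torus → ℝ≥0∞ := fun θ k x => ENNReal.ofReal (φ ((g θ)^[D * k] x)) with hu
  have hum : ∀ k, Measurable fun p : Θ × Torus => u p.1 k p.2 := fun k => hφ.comp (hgm (D * k))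
  have hum' : ∀ θ k, Measurable (u θ k) := fun θ k => hφ.comp ((hg θ).iterate _).measurable
  have hu1 : ∀ θ k x, u θ k x ≤ 1 := fun θ k x => ENNReal.ofReal_le_one.2 (h1 _)
  have hpair : ∀ k ∈ Finset.range n, ∀ l ∈ Finset.range n, ∫⁻ θ, (∫⁻ x, u θ k x * u θ l x) ∂P ≤
      (if k = l then 1 else 0) + ENNReal.ofReal b := by
    intro k hk l hl
    rw [Finset.mem_range] at hk hl
    rcases lt_trichotomy k l with h | h | h
    · rw [if_neg h.ne, zero_add]
      exact lintegral_correlation_le hg hgm hB h hl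
    · rw [if_pos h]
      refine le_trans ?_ le_self_add
      calc _ ≤ ∫⁻ _, (∫⁻ _ : Torus, 1) ∂P :=
            lintegral_mono fun θ => lintegral_mono fun x => mul_le_one' (hu1 _ _ _) (hu1 _ _ _)
        _ = 1 := by simp
    · rw [if_neg h.ne', zero_add]
      simp only [mul_comm (u _ k _)]
      exact lintegral_correlation_le hg hgm hB h hk
  have hsum : ∫⁻ θ, (∫⁻ x, (∑ k ∈ Finset.range n, u θ k x) ^ 2) ∂P ≤
      n + n * (n * ENNReal.ofReal b) := by
    calc ∫⁻ θ, (∫⁻ x, (∑ k ∈ Finset.range n, u θ k x) ^ 2) ∂P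
        = ∑ k ∈ Finset.range n, ∑ l ∈ Finset.range n, ∫⁻ θ, (∫⁻ x, u θ k x * u θ l x) ∂P := by
          have hm : ∀ k l, Measurable fun θ => ∫⁻ x, u θ k x * u θ l x := fun k l =>
            ((hum k).mul (hum l)).lintegral_prod_right'
          simp only [← lintegral_finsetSum (μ := P) _ fun l _ => hm _ l]
          rw [← lintegral_finsetSum _ fun k _ => Finset.measurable_fun_sum _ fun l _ => hm k l]
          refine lintegral_congr fun θ => ?_
          simp only [sq, Finset.sum_mul_sum]
          have hm' : ∀ k l, Measurable fun x => u θ k x * u θ l x := fun k l =>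
            (hum' θ k).mul (hum' θ l)
          rw [lintegral_finsetSum _ fun k _ => Finset.measurable_fun_sum _ fun l _ => hm' k l]
          refine Finset.sum_congr rfl fun k _ => ?_
          rw [lintegral_finsetSum _ fun l _ => hm' k l]
      _ ≤ ∑ k ∈ Finset.range n, ∑ l ∈ Finset.range n,
            ((if k = l then 1 else 0) + ENNReal.ofReal b) :=
          Finset.sum_le_sum fun k hk => Finset.sum_le_sum fun l hl => hpair k hk l hl
      _ = n + n * (n * ENNReal.ofReal b) := by
          simp only [Finset.sum_add_distrib, Finset.sum_ite_eq, Finset.sum_const,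
            Finset.card_range, nsmul_eq_mul]
          rw [Finset.sum_ite_of_true fun k hk => hk]
          simp
  -- Some environment outside the null set does not exceed the average.
  obtain ⟨θ, hθN, hθ⟩ := exists_notMem_null_le_lintegral
    (f := fun θ => ∫⁻ x, (∑ k ∈ Finset.range n, u θ k x) ^ 2)
    (Measurable.aemeasurable (Measurable.lintegral_prod_right'
      (f := fun p : Θ × Torus => (∑ k ∈ Finset.range n, u p.1 k p.2) ^ 2)
      ((Finset.measurable_fun_sum _ fun k _ => hum k).pow_const 2))) hN
  refine ⟨θ, hθN, ?_⟩
  replace hθ := hθ.trans hsum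
  have hn' : (0 : ℝ) < n := by exact_mod_cast Nat.pos_of_ne_zero hn
  set A : Torus → ℝ := fun x => ∑ k ∈ Finset.range n, φ ((g θ)^[D * k] x)
  have hA0 : ∀ x, 0 ≤ A x := fun x => Finset.sum_nonneg fun _ _ => h0 _
  have hAm : Measurable A := Finset.measurable_fun_sum _ fun k _ =>
    φ.continuous.measurable.comp ((hg θ).iterate _).measurable
  have hAn : ∀ x, A x ≤ n := fun x => by
    calc A x ≤ ∑ _ ∈ Finset.range n, (1 : ℝ) := Finset.sum_le_sum fun _ _ => h1 _
      _ = n := by simp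
  have hAi : Integrable (fun x => A x ^ 2) (volume : Measure Torus) :=
    Integrable.of_bound (hAm.pow_const 2).aestronglyMeasurable (n ^ 2 : ℝ) (ae_of_all _ fun x => by
      rw [Real.norm_eq_abs, abs_of_nonneg (by positivity)]
      exact pow_le_pow_left₀ (hA0 x) (hAn x) 2)
  have hAsq : ∫ x, A x ^ 2 ≤ n + n * (n * b) := by
    have h2 : ∀ x, (∑ k ∈ Finset.range n, u θ k x) ^ 2 = ENNReal.ofReal (A x ^ 2) := fun x => by
      rw [ENNReal.ofReal_pow (hA0 x), ENNReal.ofReal_sum_of_nonneg fun _ _ => h0 _]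
    simp only [h2] at hθ
    rw [← ofReal_integral_eq_lintegral_ofReal hAi (ae_of_all _ fun x => by positivity)] at hθ
    have h3 : (n + n * (n * ENNReal.ofReal b) : ℝ≥0∞) =
        ENNReal.ofReal (n + n * (n * b)) := by
      rw [ENNReal.ofReal_add hn'.le (by positivity), ENNReal.ofReal_mul hn'.le,
        ENNReal.ofReal_mul hn'.le, ENNReal.ofReal_natCast]
    rw [h3] at hθ
    exact (ENNReal.ofReal_le_ofReal_iff (by positivity)).1 hθ
  rw [orbitDev_eq h0 h1 (hg θ) D hn]
  have h4 : ∫ x, orbitAvg φ (g θ) D n x ^ 2 = (∫ x, A x ^ 2) / n ^ 2 := by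
    simp only [orbitAvg, div_pow]
    exact integral_div _ _
  rw [h4]
  have h5 : (∫ x, A x ^ 2) / (n : ℝ) ^ 2 ≤ 1 / n + b := by
    rw [div_le_iff₀ (by positivity)]
    refine hAsq.trans (le_of_eq ?_)
    field_simp
  linarith

/-- Every conservative map is perturbed by measurable shears, small and with finitely many values,
into a map whose averages deviate little from the mean. -/
theorem exists_orbitDev_shearPerturb_le {ε : ℝ} (hε : 0 < ε) (hε1 : ε ≤ 1) {f : C(Torus, Torus)}
    (hf : MeasurePreserving f volume volume) {φ : C(Torus, ℝ)} (h0 : ∀ x, 0 ≤ φ x)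
    (h1 : ∀ x, φ x ≤ 1) {η : ℝ} (hη : 0 < η) :
    ∃ (N : ℕ) (s : UnitAddCircle → Fin N) (α β : Fin N → ℝ) (D n : ℕ), Measurable s ∧
      (∀ i, α i ∈ Set.Icc 0 ε) ∧ (∀ i, β i ∈ Set.Icc 0 ε) ∧ n ≠ 0 ∧
      orbitDev φ (shearPerturb f (α ∘ s) (β ∘ s)) D n ≤ η := by
  have := isProbabilityMeasure_noise hε
  obtain ⟨c, hc0, hc1, hc⟩ := exists_variance_perturbOp_le hε hε1
  set m := ∫ x, φ x with hm
  -- One third each for the diagonal terms `1 / n`, the decay `c ^ D` and the coupling error. `D`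
  -- and `n` are fixed before the partition, because the coupling error grows exponentially with the
  -- horizon `2 * (D * n)`.
  set η' := η / 3 with hη'
  have hη'0 : 0 < η' := by positivity
  obtain ⟨D, hD⟩ := exists_pow_lt_of_lt_one (pow_pos hη'0 2) hc1
  obtain ⟨n, hn⟩ := exists_nat_gt (1 / η')
  have hnpos : (0 : ℝ) < n := lt_trans (by positivity) hn
  have hn0 : n ≠ 0 := by rintro rfl; simp at hnpos
  set K : ℝ≥0∞ := (3 ^ (2 * (D * n)) : ℕ) * ENNReal.ofReal ε⁻¹ ^ 2 with hK
  have hKtop : K ≠ ∞ := by finiteness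
  have hδ : ENNReal.ofReal η' / (K + 1) ≠ 0 :=
    ENNReal.div_ne_zero.2 ⟨by simpa using hη'0, by finiteness⟩
  obtain ⟨N, s, hs, hsδ⟩ := exists_measurable_fin_fiber_le hδ
  set δ := ENNReal.ofReal η' / (K + 1)
  have hKδ : K * δ ≤ ENNReal.ofReal η' := by
    calc K * δ ≤ (K + 1) * δ := by gcongr; exact le_self_add
      _ ≤ _ := ENNReal.mul_div_le
  have hvar : ∫ x, (φ x - m) ^ 2 ≤ 1 := by
    have hmu := integral_mem_unit h0 h1
    calc ∫ x, (φ x - m) ^ 2 ≤ ∫ _ : Torus, (1 : ℝ) := by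
          refine integral_mono (integrable_continuousMap ((φ - ContinuousMap.const _ m) ^ 2))
            (integrable_const 1) fun x => ?_
          have a1 := h0 x
          have a2 := h1 x
          change (φ x - m) ^ 2 ≤ 1
          rw [sq_le_one_iff_abs_le_one, abs_le]
          constructor <;> linarith
      _ = 1 := by simp
  let g : (Bool × Fin N → ℝ) → Torus → Torus := fun θ =>
    shearPerturb f (fun t => θ (false, s t)) (fun t => θ (true, s t))
  have hsm : ∀ (θ : Bool × Fin N → ℝ) b, Measurable fun t => θ (b, s t) := fun θ b =>
    (measurable_of_finite fun i => θ (b, i)).comp hs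
  have hg : ∀ θ, MeasurePreserving (g θ) volume volume := fun θ =>
    measurePreserving_shearPerturb hf (hsm θ false) (hsm θ true)
  have hB : ∀ e, D ≤ e → e ≤ D * n → ∫⁻ x, ENNReal.ofReal (φ x) *
      ∫⁻ θ, ENNReal.ofReal (φ ((g θ)^[e] x)) ∂Measure.pi (fun _ => noise ε) ≤
      ENNReal.ofReal (m ^ 2 + 2 * η') := by
    intro e hDe hen
    have hP0 : ∀ x, 0 ≤ (perturbOp ε f)^[e] φ x := by
      have : ∀ e, ∀ x, 0 ≤ (perturbOp ε f)^[e] φ x := by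
        intro e
        induction e with
        | zero => exact h0
        | succ e ih =>
          intro x
          rw [Function.iterate_succ_apply']
          exact shiftAvg_nonneg (shiftAvg_nonneg ih 1) 0 _
      exact this e
    have hpow : ∫ x, ((perturbOp ε f)^[e] φ x - m) ^ 2 ≤ η' ^ 2 := by
      calc _ ≤ c ^ e * ∫ x, (φ x - m) ^ 2 := hc f hf φ e
        _ ≤ c ^ e * 1 := by gcongr
        _ ≤ c ^ D := by rw [mul_one]; exact pow_le_pow_of_le_one hc0 hc1.le hDe
        _ ≤ _ := hD.le
    have hcor := integral_mul_iterate_perturbOp_le h0 h1 hη'0 hpow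
    calc ∫⁻ x, ENNReal.ofReal (φ x) *
          ∫⁻ θ, ENNReal.ofReal (φ ((g θ)^[e] x)) ∂Measure.pi (fun _ => noise ε)
        ≤ ∫⁻ x, (ENNReal.ofReal (φ x * (perturbOp ε f)^[e] φ x) + ENNReal.ofReal η') := by
          refine lintegral_mono fun x => ?_
          rw [ENNReal.ofReal_mul (h0 x)]
          calc _ ≤ ENNReal.ofReal (φ x) * (ENNReal.ofReal ((perturbOp ε f)^[e] φ x) +
                ENNReal.ofReal η') := by
                gcongr
                refine (lintegral_iterate_shearPerturb_le hε hε1 hf hs hsδ h0 h1 e x).trans ?_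
                gcongr
                refine le_trans ?_ hKδ
                rw [← mul_assoc, hK]
                gcongr
                norm_num
            _ = ENNReal.ofReal (φ x) * ENNReal.ofReal ((perturbOp ε f)^[e] φ x) +
                ENNReal.ofReal (φ x) * ENNReal.ofReal η' := mul_add _ _ _
            _ ≤ _ := by
                gcongr
                exact mul_le_of_le_one_left' (ENNReal.ofReal_le_one.2 (h1 x))
      _ = ENNReal.ofReal (∫ x, φ x * (perturbOp ε f)^[e] φ x) + ENNReal.ofReal η' := by
          rw [lintegral_add_right _ measurable_const, lintegral_const, measure_univ, mul_one,
            ofReal_integral_eq_lintegral_ofReal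
              (f := fun x => φ x * (perturbOp ε f)^[e] φ x)
              (integrable_continuousMap (φ * (perturbOp ε f)^[e] φ))
              (ae_of_all _ fun x => mul_nonneg (h0 x) (hP0 x))]
      _ ≤ ENNReal.ofReal (m ^ 2 + η') + ENNReal.ofReal η' := by gcongr
      _ = ENNReal.ofReal (m ^ 2 + 2 * η') := by
          rw [← ENNReal.ofReal_add (by positivity) hη'0.le]
          congr 1; ring
  -- Environments with a displacement outside `[0, ε]` are discarded as a null set.
  have hN : Measure.pi (fun _ : Bool × Fin N => noise ε) {θ | ∀ j, θ j ∈ Set.Icc 0 ε}ᶜ = 0 := by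
    rw [← mem_ae_iff]
    change ∀ᵐ θ ∂Measure.pi (fun _ : Bool × Fin N => noise ε), ∀ j, θ j ∈ Set.Icc 0 ε
    rw [ae_all_iff]
    intro j
    refine (measurePreserving_eval (fun _ => noise ε) j).quasiMeasurePreserving.ae
      (p := fun w => w ∈ Set.Icc 0 ε) ?_
    filter_upwards [ae_noise_mem] with w hw using Set.Ioc_subset_Icc_self hw
  obtain ⟨θ, hθN, hθ⟩ := exists_orbitDev_le h0 h1 hg
    (measurable_iterate_shearPerturb hf.measurable hs) (by positivity) hn0 hB hN
  simp only [Set.mem_compl_iff, not_not, Set.mem_ofPred_eq] at hθN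
  refine ⟨N, s, fun i => θ (false, i), fun i => θ (true, i), D, n, hs, fun i => hθN _,
    fun i => hθN _, hn0, hθ.trans ?_⟩
  have : 1 / (n : ℝ) ≤ η' := by
    rw [div_le_iff₀ hnpos]
    rw [div_lt_iff₀ hη'0] at hn
    linarith
  rw [← hm]
  linarith

/-! ### From step functions to continuous shears -/

/-- A function with finitely many values on the circle coincides with a continuous function off a
set of small measure. -/
theorem exists_continuous_measure_ne_le {N : ℕ} {s : UnitAddCircle → Fin N} (hs : Measurable s)
    {ε : ℝ} (hε : 0 ≤ ε) {α : Fin N → ℝ} (hα : ∀ i, α i ∈ Set.Icc 0 ε) {η : ℝ≥0∞} (hη : η ≠ 0) :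
    ∃ a : C(UnitAddCircle, ℝ), (∀ t, a t ∈ Set.Icc 0 ε) ∧ volume {t | α (s t) ≠ a t} ≤ η := by
  have hη' : η / (N + 1) ≠ 0 := ENNReal.div_ne_zero.2 ⟨hη, by finiteness⟩
  choose F hF hFc hFv using fun i => (hs (measurableSet_singleton i)).exists_isClosed_sdiff_lt
    (measure_ne_top (volume : Measure UnitAddCircle) _) hη'
  -- Inner regularity gives closed subsets of the fibres; the function is constant on each of these
  -- finitely many sets, hence continuous on their union, and Tietze extends it with values in `[0,
  -- ε]`.
  have hcont : ContinuousOn (fun t => α (s t)) (⋃ i, F i) := by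
    refine (locallyFinite_of_finite F).continuousOn_iUnion hFc fun i => ?_
    exact (continuousOn_const (c := α i)).congr fun t ht => by
      have h1 : s t = i := hF i ht
      simp only [h1]
  have hclosed : IsClosed (⋃ i, F i) := isClosed_iUnion_of_finite hFc
  obtain ⟨a, ha, hr⟩ := ContinuousMap.exists_restrict_eq_forall_mem_of_closed
    (s := ⋃ i, F i) ⟨_, hcont.domRestrict⟩ (t := Set.Icc 0 ε) (fun t => hα _)
    ⟨0, le_rfl, hε⟩ hclosed
  refine ⟨a, ha, ?_⟩
  have hsub : {t | α (s t) ≠ a t} ⊆ ⋃ i, s ⁻¹' {i} \ F i := by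
    intro t ht
    refine Set.mem_iUnion.2 ⟨s t, rfl, fun hmem => ht ?_⟩
    exact (DFunLike.congr_fun hr ⟨t, Set.mem_iUnion.2 ⟨_, hmem⟩⟩).symm
  calc volume {t | α (s t) ≠ a t} ≤ ∑ i, volume (s ⁻¹' {i} \ F i) :=
        (measure_mono hsub).trans (measure_iUnion_fintype_le _ _)
    _ ≤ ∑ _ : Fin N, η / (N + 1) := Finset.sum_le_sum fun i _ => (hFv i).le
    _ = N * (η / (N + 1)) := by simp
    _ ≤ (N + 1) * (η / (N + 1)) := by gcongr; exact le_self_add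
    _ ≤ η := ENNReal.mul_div_le

theorem iterate_eq_of_forall {X : Type*} {g h : X → X} {x : X} {n : ℕ}
    (H : ∀ k < n, g (g^[k] x) = h (g^[k] x)) : ∀ k ≤ n, h^[k] x = g^[k] x := by
  intro k hk
  induction k with
  | zero => rfl
  | succ k ih =>
    rw [Function.iterate_succ_apply', Function.iterate_succ_apply', ih (Nat.le_of_succ_le hk),
      H k hk]

/-- Two maps which agree off a small set have close orbit deviations. -/
theorem orbitDev_le_add {φ : C(Torus, ℝ)} (h0 : ∀ x, 0 ≤ φ x) (h1 : ∀ x, φ x ≤ 1)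
    {g h : Torus → Torus} (hg : MeasurePreserving g volume volume) (hh : Measurable h) (D n : ℕ)
    {δ : ℝ} (hδ0 : 0 ≤ δ) (hδ : volume {x | g x ≠ h x} ≤ ENNReal.ofReal δ) :
    orbitDev φ h D n ≤ orbitDev φ g D n + (D * n : ℕ) * δ := by
  set m := ∫ x, φ x
  have hmu := integral_mem_unit h0 h1
  set B := {x | g x ≠ h x}
  have hB : MeasurableSet B := (measurableSet_eq_fun hg.measurable hh).compl
  -- Off `C` the two orbits coincide up to time `D * n`; on `C` the integrand is at most `1`.
  set C := ⋃ k ∈ Finset.range (D * n), g^[k] ⁻¹' B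
  have hC : MeasurableSet C := Finset.measurableSet_biUnion _ fun k _ =>
    (hg.iterate k).measurable hB
  have hCv : volume.real C ≤ (D * n : ℕ) * δ := by
    refine ENNReal.toReal_le_of_le_ofReal (by positivity) ?_
    calc volume C ≤ ∑ k ∈ Finset.range (D * n), volume (g^[k] ⁻¹' B) :=
          measure_biUnion_finset_le _ _
      _ ≤ ∑ k ∈ Finset.range (D * n), ENNReal.ofReal δ := Finset.sum_le_sum fun k _ =>
          ((hg.iterate k).measure_preimage hB.nullMeasurableSet).le.trans hδ
      _ = ENNReal.ofReal ((D * n : ℕ) * δ) := by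
          rw [ENNReal.ofReal_mul (by positivity), ENNReal.ofReal_natCast]
          simp
  have hbd : ∀ u : Torus → Torus, ∀ x, (orbitAvg φ u D n x - m) ^ 2 ≤ 1 := fun u x => by
    have h2 := orbitAvg_mem_unit h0 h1 u D n x
    rw [sq_le_one_iff_abs_le_one, abs_le]
    constructor <;> linarith [h2.1, h2.2, hmu.1, hmu.2]
  have hint : ∀ u : Torus → Torus, Measurable u →
      Integrable (fun x => (orbitAvg φ u D n x - m) ^ 2) (volume : Measure Torus) := fun u hu =>
    Integrable.of_bound (((measurable_orbitAvg φ.continuous.measurable hu D n).sub_const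
      _).pow_const 2).aestronglyMeasurable 1 (ae_of_all _ fun x => by
        rw [Real.norm_eq_abs, abs_of_nonneg (by positivity)]; exact hbd u x)
  have hCi : Integrable (C.indicator (1 : Torus → ℝ)) (volume : Measure Torus) :=
    (integrable_const (1 : ℝ)).indicator hC
  calc orbitDev φ h D n
      ≤ ∫ x, ((orbitAvg φ g D n x - m) ^ 2 + C.indicator 1 x) := by
        refine integral_mono (hint h hh) ((hint g hg.measurable).add hCi) fun x => ?_
        by_cases hx : x ∈ C
        · simp only [Set.indicator_of_mem hx, Pi.one_apply]
          have := hbd h x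
          have : 0 ≤ (orbitAvg φ g D n x - m) ^ 2 := by positivity
          linarith
        · have h3 : orbitAvg φ h D n x = orbitAvg φ g D n x := by
            have h4 : ∀ k < D * n, g (g^[k] x) = h (g^[k] x) := fun k hk => by
              by_contra hne
              exact hx (Set.mem_biUnion (Finset.mem_coe.2 (Finset.mem_range.2 hk)) hne)
            simp only [orbitAvg]
            congr 1
            refine Finset.sum_congr rfl fun k hk => ?_
            rw [iterate_eq_of_forall h4 _ (Nat.mul_le_mul_left _ (Finset.mem_range.1 hk).le)]
          simp only [h3, Set.indicator_of_notMem hx, add_zero]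
          exact le_rfl
    _ = orbitDev φ g D n + volume.real C := by
        rw [integral_add (hint g hg.measurable) hCi, integral_indicator_one hC]
        rfl
    _ ≤ _ := by gcongr

/-- The maps differ only if one of the two coordinates at which a displacement is read lies in a bad
set, and both coordinates are distributed uniformly. -/
theorem measure_shearPerturb_ne_le {f : Torus → Torus} (hf : MeasurePreserving f volume volume)
    {a b a' b' : UnitAddCircle → ℝ} (ha : Measurable a) (hb : Measurable b) (ha' : Measurable a')
    (hb' : Measurable b') {η : ℝ≥0∞} (h1 : volume {t | a t ≠ a' t} ≤ η)
    (h2 : volume {t | b t ≠ b' t} ≤ η) :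
    volume {x | shearPerturb f a b x ≠ shearPerturb f a' b' x} ≤ η + η := by
  have hA : MeasurableSet {t | a t ≠ a' t} := (measurableSet_eq_fun ha ha').compl
  have hB : MeasurableSet {t | b t ≠ b' t} := (measurableSet_eq_fun hb hb').compl
  have m1 := (measurePreserving_torus_eval 1).comp hf
  have m2 := (measurePreserving_torus_eval 0).comp
    ((measurePreserving_shear (i := 0) (j := 1) (by decide) ha).comp hf)
  have hsub : {x | shearPerturb f a b x ≠ shearPerturb f a' b' x} ⊆
      ((fun z : Torus => z 1) ∘ f) ⁻¹' {t | a t ≠ a' t} ∪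
      ((fun z : Torus => z 0) ∘ (shear 0 1 a ∘ f)) ⁻¹' {t | b t ≠ b' t} := by
    intro x hx
    by_contra hn
    simp only [Set.mem_union, Set.mem_preimage, Set.mem_ofPred_eq, not_or, not_not,
      Function.comp_apply] at hn
    refine hx ?_
    have e1 : shear 0 1 a' (f x) = shear 0 1 a (f x) := by simp only [shear, hn.1]
    have e2 : ∀ z : Torus, b (z 0) = b' (z 0) → shear 1 0 b z = shear 1 0 b' z := fun z hz => by
      simp only [shear, hz]
    rw [shearPerturb, shearPerturb, e1, e2 _ hn.2]
  refine (measure_mono hsub).trans ((measure_union_le _ _).trans (add_le_add ?_ ?_))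
  · rw [m1.measure_preimage hA.nullMeasurableSet]; exact h1
  · rw [m2.measure_preimage hB.nullMeasurableSet]; exact h2

/-- A continuous shear as a homeomorphism of the torus. -/
noncomputable def shearHomeo (i j : Fin 2) (h : j ≠ i) (a : C(UnitAddCircle, ℝ)) :
    Torus ≃ₜ Torus where
  toFun := shear i j a
  invFun := shear i j (-a)
  left_inv z := by rw [shear_shear i h, add_neg_cancel, shear_zero]
  right_inv z := by rw [shear_shear i h, neg_add_cancel, shear_zero]
  continuous_toFun := by
    have := continuous_shiftVec i
    unfold shear
    fun_prop
  continuous_invFun := by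
    have := continuous_shiftVec i
    unfold shear
    simp only [Pi.neg_apply]
    fun_prop

/-- The perturbation of a conservative homeomorphism by two continuous shears. -/
noncomputable def ConsHomeo.perturb (f : ConsHomeo) (a b : C(UnitAddCircle, ℝ)) : ConsHomeo where
  toHomeo := (f.toHomeo.trans (shearHomeo 0 1 (by decide) a)).trans (shearHomeo 1 0 (by decide) b)
  measurePreserving := measurePreserving_shearPerturb f.measurePreserving
    a.continuous.measurable b.continuous.measurable

theorem dist_shear_le (i j : Fin 2) {a : UnitAddCircle → ℝ} {ε : ℝ} (ha : ∀ t, a t ∈ Set.Icc 0 ε)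
    (z : Torus) : dist (shear i j a z) z ≤ ε := by
  have h0 := ha (z j)
  rw [shear, dist_eq_norm, add_sub_cancel_left, shiftVec, Pi.norm_single]
  refine QuotientAddGroup.norm_mk_le_norm.trans ?_
  rw [Real.norm_eq_abs, abs_of_nonneg h0.1]
  exact h0.2

theorem ConsHomeo.dist_perturb_le (f : ConsHomeo) {a b : C(UnitAddCircle, ℝ)} {ε : ℝ}
    (ha : ∀ t, a t ∈ Set.Icc 0 ε) (hb : ∀ t, b t ∈ Set.Icc 0 ε) :
    dist (f.perturb a b) f ≤ ε + ε := by
  have hε : 0 ≤ ε := (ha 0).1.trans (ha 0).2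
  refine (ConsHomeo.dist_le_iff _ _ (by positivity)).2 fun x => ?_
  exact (dist_triangle _ (shear 0 1 a (f.toHomeo x)) _).trans
    (add_le_add (dist_shear_le 1 0 hb _) (dist_shear_le 0 1 ha _))

/-- Conservative homeomorphisms whose averages deviate little from the mean are dense. -/
theorem exists_dist_lt_orbitDev_lt (f : ConsHomeo) {φ : C(Torus, ℝ)} (h0 : ∀ x, 0 ≤ φ x)
    (h1 : ∀ x, φ x ≤ 1) {r η : ℝ} (hr : 0 < r) (hη : 0 < η) :
    ∃ g : ConsHomeo, dist g f < r ∧ ∃ D n, n ≠ 0 ∧ orbitDev φ g.toHomeo D n < η := by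
  set ε := min (r / 3) 1
  have hε : 0 < ε := lt_min (by positivity) one_pos
  obtain ⟨N, s, α, β, D, n, hs, hα, hβ, hn, hdev⟩ := exists_orbitDev_shearPerturb_le hε
    (min_le_right _ _) (f := f.toContinuousMap) f.measurePreserving h0 h1
    (η := η / 2) (by positivity)
  set δ := η / (8 * ((D * n : ℕ) + 1))
  have hδ : 0 < δ := by positivity
  have hδ' : ENNReal.ofReal δ ≠ 0 := by simpa using hδ
  obtain ⟨a, ha, hav⟩ := exists_continuous_measure_ne_le hs hε.le hα hδ'
  obtain ⟨b, hb, hbv⟩ := exists_continuous_measure_ne_le hs hε.le hβ hδ'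
  refine ⟨f.perturb a b, ?_, D, n, hn, ?_⟩
  · refine (f.dist_perturb_le ha hb).trans_lt ?_
    have : ε ≤ r / 3 := min_le_left _ _
    linarith
  · have hαs : Measurable (α ∘ s) := (measurable_of_finite α).comp hs
    have hβs : Measurable (β ∘ s) := (measurable_of_finite β).comp hs
    have hne := measure_shearPerturb_ne_le f.measurePreserving hαs hβs a.continuous.measurable
      b.continuous.measurable hav hbv
    rw [← ENNReal.ofReal_add hδ.le hδ.le] at hne
    have h := orbitDev_le_add h0 h1 (measurePreserving_shearPerturb f.measurePreserving hαs hβs)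
      (f.perturb a b).measurePreserving.measurable D n (by positivity) hne
    refine h.trans_lt ?_
    have h2 : ((D * n : ℕ) : ℝ) * (δ + δ) < η / 2 := by
      have h3 : (((D * n : ℕ) : ℝ) + 1) * (δ + δ) = η / 4 := by
        simp only [δ]; field_simp; norm_num
      nlinarith
    have h4 : orbitDev φ (shearPerturb f.toHomeo (α ∘ s) (β ∘ s)) D n ≤ η / 2 := hdev
    linarith

/-! ### Topology of the space of conservative homeomorphisms -/

namespace ConsHomeo

theorem isEmbedding_toContinuousMap : IsEmbedding toContinuousMap :=
  ⟨⟨rfl⟩, toContinuousMap_injective⟩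

theorem continuous_eval : Continuous fun p : ConsHomeo × Torus => p.1.toHomeo p.2 :=
  (ContinuousEval.continuous_eval (F := C(Torus, Torus))).comp
    ((isEmbedding_toContinuousMap.continuous.comp continuous_fst).prodMk continuous_snd)

theorem continuous_iterate (k : ℕ) (x : Torus) :
    Continuous fun f : ConsHomeo => f.toHomeo^[k] x := by
  induction k with
  | zero => exact continuous_const
  | succ k ih =>
    simp only [Function.iterate_succ_apply']
    exact continuous_eval.comp (continuous_id.prodMk ih)

theorem continuous_orbitDev {φ : C(Torus, ℝ)} (h0 : ∀ x, 0 ≤ φ x) (h1 : ∀ x, φ x ≤ 1) (D n : ℕ) :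
    Continuous fun f : ConsHomeo => orbitDev φ f.toHomeo D n := by
  have hmu := integral_mem_unit h0 h1
  refine continuous_of_dominated (bound := fun _ => 1) (fun f => ?_)
    (fun f => ae_of_all _ fun x => ?_) (integrable_const _) (ae_of_all _ fun x => ?_)
  · exact (((measurable_orbitAvg φ.continuous.measurable f.toHomeo.continuous.measurable D
      n).sub_const _).pow_const 2).aestronglyMeasurable
  · have h2 := orbitAvg_mem_unit h0 h1 f.toHomeo D n x
    rw [Real.norm_eq_abs, abs_of_nonneg (by positivity), sq_le_one_iff_abs_le_one, abs_le]
    constructor <;> linarith [h2.1, h2.2, hmu.1, hmu.2]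
  · have h3 : ∀ k, Continuous fun f : ConsHomeo => φ (f.toHomeo^[k] x) := fun k =>
      φ.continuous.comp (continuous_iterate k x)
    exact (((continuous_finsetSum _ fun k _ => h3 (D * k)).div_const _).sub
      continuous_const).pow 2

/-- The inverse of a conservative homeomorphism, as a continuous map. -/
def inv (f : ConsHomeo) : C(Torus, Torus) := ⟨f.toHomeo.symm, f.toHomeo.symm.continuous⟩

/-- Apply the uniformly continuous inverse of `f` to the nearby points `x = g (g⁻¹ x)` and `f (g⁻¹
x)`. -/
theorem continuous_inv : Continuous inv := by
  rw [Metric.continuous_iff]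
  intro f ε hε
  obtain ⟨δ, hδ, h⟩ := Metric.uniformContinuous_iff.1
    (CompactSpace.uniformContinuous_of_continuous f.toHomeo.symm.continuous) (ε / 2) (half_pos hε)
  refine ⟨δ, hδ, fun g hg => lt_of_le_of_lt ?_ (half_lt_self hε)⟩
  refine (ContinuousMap.dist_le (half_pos hε).le).2 fun x => ?_
  have h1 : dist (g.toHomeo (g.toHomeo.symm x)) (f.toHomeo (g.toHomeo.symm x)) < δ :=
    lt_of_le_of_lt ((dist_le_iff g f dist_nonneg).1 le_rfl _) hg
  have h2 := h h1
  rw [Homeomorph.apply_symm_apply, Homeomorph.symm_apply_apply] at h2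
  rw [dist_comm]
  exact h2.le

/-- A uniform limit of homeomorphisms need not be injective. Recording the inverse as well turns
invertibility into closed equations, and invariance is closed when tested on continuous functions.
Complete metrizability, hence the Baire property, follows. -/
theorem isClosedEmbedding_prod_inv :
    IsClosedEmbedding fun f : ConsHomeo => (f.toContinuousMap, f.inv) := by
  refine ⟨.of_comp (isEmbedding_toContinuousMap.continuous.prodMk continuous_inv) continuous_fst
    isEmbedding_toContinuousMap, ?_⟩
  have hr : Set.range (fun f : ConsHomeo => (f.toContinuousMap, f.inv)) =
      ({p | p.1.comp p.2 = ContinuousMap.id Torus} ∩ {p | p.2.comp p.1 = ContinuousMap.id Torus}) ∩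
      ⋂ φ : BoundedContinuousFunction Torus ℝ,
        {p : C(Torus, Torus) × C(Torus, Torus) | ∫ x, φ (p.1 x) = ∫ x, φ x} := by
    ext ⟨F, G⟩
    constructor
    · rintro ⟨f, hf⟩
      obtain ⟨rfl, rfl⟩ := Prod.mk.inj hf
      refine ⟨⟨ContinuousMap.ext f.toHomeo.apply_symm_apply,
        ContinuousMap.ext f.toHomeo.symm_apply_apply⟩, Set.mem_iInter.2 fun φ => ?_⟩
      exact integral_comp_measurePreserving f.measurePreserving φ.continuous.measurable
    · rintro ⟨⟨h1, h2⟩, h3⟩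
      refine ⟨⟨⟨⟨F, G, fun x => DFunLike.congr_fun h2 x, fun x => DFunLike.congr_fun h1 x⟩,
        F.continuous, G.continuous⟩, F.continuous.measurable, ?_⟩, rfl⟩
      have hFm : Measurable F := F.continuous.measurable
      have : IsProbabilityMeasure (Measure.map F (volume : Measure Torus)) :=
        Measure.isProbabilityMeasure_map hFm.aemeasurable
      refine ext_of_forall_integral_eq_of_IsFiniteMeasure fun φ => ?_
      exact (integral_map hFm.aemeasurable
        φ.continuous.measurable.aestronglyMeasurable).trans (Set.mem_iInter.1 h3 φ)
  rw [hr]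
  refine ((isClosed_eq (continuous_fst.compCM continuous_snd) continuous_const).inter
    (isClosed_eq (continuous_snd.compCM continuous_fst) continuous_const)).inter
    (isClosed_iInter fun φ => isClosed_eq ?_ continuous_const)
  refine continuous_of_dominated (bound := fun _ => ‖φ‖) (fun p => ?_)
    (fun p => ae_of_all _ fun x => φ.norm_coe_le_norm _) (integrable_const _)
    (ae_of_all _ fun x => ?_)
  · exact (φ.continuous.comp p.1.continuous).measurable.aestronglyMeasurable
  · exact φ.continuous.comp ((continuous_eval_const (F := C(Torus, Torus)) x).comp continuous_fst)

instance : BaireSpace ConsHomeo :=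
  have := isClosedEmbedding_prod_inv.IsCompletelyMetrizableSpace
  inferInstance

/-- Uniformly close continuous maps of the torus are homotopic. -/
theorem homotopic_of_dist_lt {F G : C(Torus, Torus)} (h : dist F G < 1 / 2) : F.Homotopic G := by
  -- The lift to `[-1/2, 1/2)` jumps only at the antipode of `0`, which the distance bound excludes;
  -- the homotopy moves along the lifted difference.
  let l : UnitAddCircle → ℝ := fun u => (AddCircle.equivIco 1 (-(1 / 2)) u : ℝ)
  have hl : ∀ u, (l u : UnitAddCircle) = u :=
    fun u => (AddCircle.equivIco 1 (-(1 / 2))).symm_apply_apply u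
  have hc : ∀ i, Continuous fun x => l (G x i - F x i) := by
    refine fun i => continuous_iff_continuousAt.2 fun x => ?_
    have hd : dist (F x i) (G x i) < 1 / 2 :=
      ((dist_le_pi_dist (F x) (G x) i).trans (ContinuousMap.dist_apply_le_dist x)).trans_lt h
    have hne : G x i - F x i ≠ ((-(1 / 2) : ℝ) : UnitAddCircle) := by
      intro he
      rw [dist_comm, dist_eq_norm, he, AddCircle.coe_neg, norm_neg,
        AddCircle.norm_half_period_eq] at hd
      norm_num at hd
    have h2 : ContinuousAt (fun x => G x i - F x i) x := by fun_prop
    exact (continuous_subtype_val.continuousAt.comp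
      (AddCircle.continuousAt_equivIco 1 (-(1 / 2)) hne)).comp_of_eq h2 rfl
  refine ⟨⟨⟨fun p i => F p.2 i + (((p.1 : ℝ) * l (G p.2 i - F p.2 i) : ℝ) : UnitAddCircle), ?_⟩,
    fun x => ?_, fun x => ?_⟩⟩
  · refine continuous_pi fun i => ?_
    have h1 : Continuous fun p : unitInterval × Torus => (p.1 : ℝ) * l (G p.2 i - F p.2 i) :=
      (continuous_subtype_val.comp continuous_fst).mul ((hc i).comp continuous_snd)
    have h2 : Continuous fun p : unitInterval × Torus => F p.2 i := by fun_prop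
    exact h2.add ((AddCircle.continuous_mk' 1).comp h1)
  · ext i
    simp
  · ext i
    simp [hl]

theorem isOpen_homotopicToId : IsOpen {f : ConsHomeo | f.HomotopicToId} := by
  refine Metric.isOpen_iff.2 fun f hf => ⟨1 / 2, by norm_num, fun g hg => ?_⟩
  exact (homotopic_of_dist_lt (F := g.toContinuousMap) (G := f.toContinuousMap) hg).trans hf

end ConsHomeo

/-! ### From small deviation to almost everywhere convergence -/

section Convergence

variable {g : Torus → Torus}

theorem birkhoffSum_mem_Icc {φ : C(Torus, ℝ)} (h0 : ∀ x, 0 ≤ φ x) (h1 : ∀ x, φ x ≤ 1) (n : ℕ)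
    (x : Torus) : birkhoffSum g φ n x ∈ Set.Icc (0 : ℝ) n := by
  refine ⟨Finset.sum_nonneg fun _ _ => h0 _, ?_⟩
  calc _ ≤ ∑ _ ∈ Finset.range n, (1 : ℝ) := Finset.sum_le_sum fun _ _ => h1 _
    _ = n := by simp

/-- Splitting the sum of length `j + N` in two ways leaves only boundary blocks of length `j`. -/
theorem abs_birkhoffSum_iterate_sub_le {φ : C(Torus, ℝ)} (h0 : ∀ x, 0 ≤ φ x) (h1 : ∀ x, φ x ≤ 1)
    (j N : ℕ) (x : Torus) :
    |birkhoffSum g φ N (g^[j] x) - birkhoffSum g φ N x| ≤ j := by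
  have e1 := birkhoffSum_add g φ j N x
  have e2 := birkhoffSum_add g φ N j x
  rw [add_comm N j] at e2
  have b1 := birkhoffSum_mem_Icc (g := g) h0 h1 j x
  have b2 := birkhoffSum_mem_Icc (g := g) h0 h1 j (g^[N] x)
  rw [abs_le]
  constructor <;> linarith [b1.1, b1.2, b2.1, b2.2]

theorem abs_birkhoffSum_orbitAvg_sub_le {φ : C(Torus, ℝ)} (h0 : ∀ x, 0 ≤ φ x) (h1 : ∀ x, φ x ≤ 1)
    (D : ℕ) {n : ℕ} (hn : n ≠ 0) (N : ℕ) (x : Torus) :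
    |birkhoffSum g (orbitAvg φ g D n) N x - birkhoffSum g φ N x| ≤ D * n := by
  have hn' : (0 : ℝ) < n := by exact_mod_cast Nat.pos_of_ne_zero hn
  have e : birkhoffSum g (orbitAvg φ g D n) N x =
      (∑ k ∈ Finset.range n, birkhoffSum g φ N (g^[D * k] x)) / n := by
    simp only [birkhoffSum, orbitAvg]
    rw [← Finset.sum_div, Finset.sum_comm]
    simp only [← Function.iterate_add_apply, add_comm]
  have e2 : (∑ k ∈ Finset.range n, birkhoffSum g φ N (g^[D * k] x)) / n - birkhoffSum g φ N x =
      (∑ k ∈ Finset.range n, (birkhoffSum g φ N (g^[D * k] x) - birkhoffSum g φ N x)) / n := by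
    rw [Finset.sum_sub_distrib]
    simp only [Finset.sum_const, Finset.card_range, nsmul_eq_mul]
    field_simp
  rw [e, e2, abs_div, abs_of_pos hn', div_le_iff₀ hn']
  calc _ ≤ ∑ k ∈ Finset.range n, |birkhoffSum g φ N (g^[D * k] x) - birkhoffSum g φ N x| :=
        Finset.abs_sum_le_sum_abs _ _
    _ ≤ ∑ k ∈ Finset.range n, (D * n : ℝ) := Finset.sum_le_sum fun k hk => by
        refine (abs_birkhoffSum_iterate_sub_le h0 h1 (D * k) N x).trans ?_
        push_cast
        gcongr
        exact (Finset.mem_range.1 hk).le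
    _ = D * n * n := by simp [mul_comm]

theorem integral_abs_orbitAvg_sub_le {φ : C(Torus, ℝ)} (h0 : ∀ x, 0 ≤ φ x) (h1 : ∀ x, φ x ≤ 1)
    (hg : Measurable g) {D n : ℕ} {η : ℝ} (hη : 0 < η) (h : orbitDev φ g D n ≤ η ^ 2) :
    Integrable (fun x => |orbitAvg φ g D n x - ∫ y, φ y|) volume ∧
      ∫ x, |orbitAvg φ g D n x - ∫ y, φ y| ≤ η := by
  set m := ∫ y, φ y
  have hmu := integral_mem_unit h0 h1
  have hm := (measurable_orbitAvg φ.continuous.measurable hg D n).sub_const m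
  have hb : ∀ x, |orbitAvg φ g D n x - m| ≤ 1 := fun x => by
    have h2 := orbitAvg_mem_unit h0 h1 g D n x
    rw [abs_le]
    constructor <;> linarith [h2.1, h2.2, hmu.1, hmu.2]
  have hi1 : Integrable (fun x => |orbitAvg φ g D n x - m|) (volume : Measure Torus) :=
    Integrable.of_bound hm.abs.aestronglyMeasurable 1 (ae_of_all _ fun x => by
      rw [Real.norm_eq_abs, abs_abs]; exact hb x)
  have hi2 : Integrable (fun x => (orbitAvg φ g D n x - m) ^ 2) (volume : Measure Torus) :=
    Integrable.of_bound (hm.pow_const 2).aestronglyMeasurable 1 (ae_of_all _ fun x => by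
      rw [Real.norm_eq_abs, abs_of_nonneg (by positivity)]
      exact (sq_le_one_iff_abs_le_one _).2 (hb x))
  refine ⟨hi1, ?_⟩
  calc ∫ x, |orbitAvg φ g D n x - m|
      ≤ ∫ x, (η / 2 + (2 * η)⁻¹ * (orbitAvg φ g D n x - m) ^ 2) := by
        refine integral_mono hi1 ((integrable_const _).add (hi2.const_mul _)) fun x => ?_
        simp only
        rw [← sq_abs (orbitAvg φ g D n x - m)]
        have : η / 2 + (2 * η)⁻¹ * |orbitAvg φ g D n x - m| ^ 2 - |orbitAvg φ g D n x - m| =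
            (2 * η)⁻¹ * (|orbitAvg φ g D n x - m| - η) ^ 2 := by field_simp; ring
        have h4 : 0 ≤ (2 * η)⁻¹ * (|orbitAvg φ g D n x - m| - η) ^ 2 := by positivity
        linarith
    _ = η / 2 + (2 * η)⁻¹ * orbitDev φ g D n := by
        rw [integral_add (integrable_const _) (hi2.const_mul _), integral_const_mul]
        simp [orbitDev, m]
    _ ≤ η / 2 + (2 * η)⁻¹ * η ^ 2 := by gcongr
    _ = η := by field_simp; ring

/-- If the averages of `φ` deviate arbitrarily little from the mean, the Birkhoff averages of `φ`
converge almost everywhere to the mean. -/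
theorem ae_tendsto_birkhoffSum_div {φ : C(Torus, ℝ)} (h0 : ∀ x, 0 ≤ φ x) (h1 : ∀ x, φ x ≤ 1)
    (hg : MeasurePreserving g volume volume)
    (h : ∀ η : ℝ, 0 < η → ∃ D n, n ≠ 0 ∧ orbitDev φ g D n < η) :
    ∀ᵐ x, Tendsto (fun N : ℕ => birkhoffSum g φ N x / N) atTop (𝓝 (∫ y, φ y)) := by
  set m := ∫ y, φ y
  have key : ∀ l : ℝ, 0 < l →
      ∀ᵐ x, ∀ᶠ N : ℕ in atTop, |birkhoffSum g φ N x - m * N| ≤ 2 * l * N := by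
    intro l hl
    rw [ae_iff]
    refine le_antisymm (le_of_forall_pos_le_add fun η hη => ?_) zero_le
    rw [zero_add]
    obtain ⟨r, hr0, hr⟩ : ∃ r : ℝ, 0 < r ∧ ENNReal.ofReal (r / l) ≤ η := by
      obtain ⟨q, hq0, hq⟩ := ENNReal.lt_iff_exists_nnreal_btwn.1 hη
      have hq0' : 0 < (q : ℝ) := by exact_mod_cast hq0
      refine ⟨l * q, by positivity, ?_⟩
      rw [mul_div_cancel_left₀ _ hl.ne', ENNReal.ofReal_coe_nnreal]
      exact hq.le
    obtain ⟨D, n, hn, hdev⟩ := h (r ^ 2) (by positivity)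
    obtain ⟨hi, hle⟩ := integral_abs_orbitAvg_sub_le h0 h1 hg.measurable hr0 hdev.le
    -- The weak type bound applied to this deviation controls every `N` at once, though its
    -- smallness is known for a single pair `D`, `n`.
    set C : Torus → ℝ := fun x => |orbitAvg φ g D n x - m|
    have hCm : Measurable C :=
      ((measurable_orbitAvg φ.continuous.measurable hg.measurable D n).sub_const m).abs
    have hmax := measure_exists_lt_birkhoffSum_le hg hCm hi (fun x => abs_nonneg _) hl
    refine (measure_mono fun x hx => ?_).trans (hmax.trans ((ENNReal.ofReal_le_ofReal
      (div_le_div_of_nonneg_right hle hl.le)).trans hr))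
    by_contra hx'
    refine hx ?_
    have hx2 : ∀ N : ℕ, birkhoffSum g C N x ≤ l * N := by
      simpa using hx'
    -- Beyond `N₀` the boundary error `D * n` is absorbed into `l * N`.
    obtain ⟨N₀, hN₀⟩ := exists_nat_gt ((D * n : ℝ) / l)
    filter_upwards [eventually_ge_atTop N₀] with N hN
    have a1 := abs_birkhoffSum_orbitAvg_sub_le (g := g) h0 h1 D hn N x
    have a2 : |birkhoffSum g (orbitAvg φ g D n) N x - m * N| ≤ l * N := by
      refine le_trans ?_ (hx2 N)
      have : birkhoffSum g (orbitAvg φ g D n) N x - m * N =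
          ∑ k ∈ Finset.range N, (orbitAvg φ g D n (g^[k] x) - m) := by
        simp [birkhoffSum, mul_comm]
      rw [this]
      exact Finset.abs_sum_le_sum_abs _ _
    have a3 : (D * n : ℝ) ≤ l * N := by
      rw [div_lt_iff₀ hl] at hN₀
      have : (N₀ : ℝ) ≤ N := by exact_mod_cast hN
      nlinarith
    rw [abs_le] at a1 a2 ⊢
    constructor <;> linarith [a1.1, a1.2, a2.1, a2.2]
  have hall : ∀ᵐ x, ∀ p : ℕ, ∀ᶠ N : ℕ in atTop,
      |birkhoffSum g φ N x - m * N| ≤ 2 * (1 / ((p : ℝ) + 1)) * N :=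
    ae_all_iff.2 fun p => key _ (by positivity)
  filter_upwards [hall] with x hx
  rw [Metric.tendsto_atTop']
  intro δ hδ
  obtain ⟨p, hp⟩ := exists_nat_one_div_lt (half_pos hδ)
  obtain ⟨N₀, hN₀⟩ := eventually_atTop.1 (hx p)
  refine ⟨N₀, fun N hN => ?_⟩
  have hNpos : (0 : ℝ) < N := by exact_mod_cast (Nat.zero_le N₀).trans_lt hN
  rw [Real.dist_eq, div_sub' hNpos.ne', abs_div, abs_of_pos hNpos, div_lt_iff₀ hNpos,
    mul_comm (N : ℝ) m]
  calc _ ≤ 2 * (1 / ((p : ℝ) + 1)) * N := hN₀ N hN.le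
    _ < δ * N := by gcongr; linarith

theorem integral_empirical (x : Torus) (n : ℕ) (φ : Torus → ℝ) :
    ∫ y, φ y ∂(empirical g x n : Measure Torus) =
      birkhoffSum g φ (n + 1) x / (n + 1 : ℕ) := by
  change ∫ y, φ y ∂(((n + 1 : ℕ) : ℝ≥0∞)⁻¹ •
    ∑ k ∈ Finset.range (n + 1), Measure.dirac (g^[k] x)) = _
  rw [integral_smul_measure, integral_finsetSum_measure fun _ _ => integrable_dirac (by simp)]
  simp only [integral_dirac, ENNReal.toReal_inv, ENNReal.toReal_natCast, smul_eq_mul, birkhoffSum]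
  rw [mul_comm, div_eq_mul_inv]

theorem abs_integral_sub_integral_le (μ : Measure Torus) [IsProbabilityMeasure μ]
    (φ ψ : C(Torus, ℝ)) : |∫ x, φ x ∂μ - ∫ x, ψ x ∂μ| ≤ dist φ ψ := by
  have hi : ∀ φ : C(Torus, ℝ), Integrable φ μ := fun φ =>
    integrable_of_continuousMap φ measurable_id
  rw [← integral_sub (hi φ) (hi ψ)]
  have h := norm_integral_le_of_norm_le_const (μ := μ) (f := fun x => φ x - ψ x) (C := dist φ ψ)
    (ae_of_all _ fun x => (Real.dist_eq (φ x) (ψ x)).symm.le.trans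
      (ContinuousMap.dist_apply_le_dist x))
  rwa [probReal_univ, mul_one, Real.norm_eq_abs] at h

theorem tendsto_leb_of_forall_unit {μ : ℕ → ProbabilityMeasure Torus}
    {S : Set {φ : C(Torus, ℝ) // ∀ x, 0 ≤ φ x ∧ φ x ≤ 1}} (hS : Dense S)
    (h : ∀ φ ∈ S, Tendsto (fun n => ∫ x, φ.1 x ∂(μ n : Measure Torus)) atTop
      (𝓝 (∫ x, φ.1 x))) : Tendsto μ atTop (𝓝 leb) := by
  have hunit : ∀ φ : {φ : C(Torus, ℝ) // ∀ x, 0 ≤ φ x ∧ φ x ≤ 1},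
      Tendsto (fun n => ∫ x, φ.1 x ∂(μ n : Measure Torus)) atTop (𝓝 (∫ x, φ.1 x)) := by
    intro φ
    rw [Metric.tendsto_atTop]
    intro δ hδ
    obtain ⟨ψ, hψS, hψ⟩ := Metric.dense_iff.1 hS φ (δ / 3) (by positivity)
    have hψ' : dist φ.1 ψ.1 < δ / 3 := by
      rw [dist_comm]; exact hψS
    obtain ⟨N, hN⟩ := Metric.tendsto_atTop.1 (h ψ hψ) (δ / 3) (by positivity)
    refine ⟨N, fun n hn => ?_⟩
    have b1 := abs_integral_sub_integral_le (μ n : Measure Torus) φ.1 ψ.1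
    have b2 := abs_integral_sub_integral_le (volume : Measure Torus) φ.1 ψ.1
    have b3 := hN n hn
    rw [Real.dist_eq] at b3 ⊢
    rw [abs_lt] at b3 ⊢
    rw [abs_le] at b1 b2
    constructor <;> linarith [b1.1, b1.2, b2.1, b2.2, b3.1, b3.2]
  rw [ProbabilityMeasure.tendsto_iff_forall_integral_tendsto]
  intro φ
  set B := ‖φ‖ + 1
  have hB : 0 < B := by positivity
  have hφB : ∀ x, |φ x| ≤ B := fun x => (φ.norm_coe_le_norm x).trans (by simp [B])
  -- An affine rescaling into `[0, 1]`, undone in `hφψ` for every probability measure.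
  let ψ : C(Torus, ℝ) := ⟨fun x => (2 * B)⁻¹ * (φ x + B), by fun_prop⟩
  have hψ : ∀ x, 0 ≤ ψ x ∧ ψ x ≤ 1 := fun x => by
    have := abs_le.1 (hφB x)
    refine ⟨mul_nonneg (by positivity) (by linarith), ?_⟩
    change (2 * B)⁻¹ * (φ x + B) ≤ 1
    rw [inv_mul_le_iff₀ (by positivity)]
    linarith
  have hφψ : ∀ ν : Measure Torus, IsProbabilityMeasure ν →
      ∫ x, φ x ∂ν = 2 * B * ∫ x, ψ x ∂ν - B := by
    intro ν _
    have h1 : ∀ x, φ x = 2 * B * ψ x - B := fun x => by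
      change φ x = 2 * B * ((2 * B)⁻¹ * (φ x + B)) - B
      field_simp; ring
    simp only [h1]
    have hi : Integrable ψ ν := integrable_of_continuousMap ψ measurable_id
    rw [integral_sub (hi.const_mul _) (integrable_const _), integral_const_mul]
    simp
  have e1 : ∀ n, ∫ x, φ x ∂(μ n : Measure Torus) = 2 * B * ∫ x, ψ x ∂(μ n : Measure Torus) - B :=
    fun n => hφψ _ inferInstance
  have e2 : ∫ x, φ x ∂(leb : Measure Torus) = 2 * B * (∫ x, ψ x) - B := hφψ _ inferInstance
  simp only [e1, e2]
  exact ((hunit ⟨ψ, hψ⟩).const_mul _).sub_const _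

end Convergence

/-! ### Genericity and conclusion -/

/-- If the empirical measures of almost every point converge to Lebesgue measure, then Lebesgue
measure is the only observable measure and the only physical measure. -/
theorem obsPhysEqLeb_of_ae_tendsto (f : ConsHomeo)
    (h : ∀ᵐ x, Tendsto (empirical f.toHomeo x) atTop (𝓝 leb)) : ObsPhysEqLeb f := by
  have hpos : ∀ A : Set Torus, (∀ᵐ x, x ∈ A) → 0 < (volume : Measure Torus) A := by
    intro A hA
    have : volume A = 1 := by
      rw [measure_eq_measure_of_null_sdiff (Set.subset_univ A) (by
        rw [← Set.compl_eq_univ_sdiff]; exact hA), measure_univ]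
    rw [this]
    exact one_pos
  constructor
  · intro d _
    ext μ
    constructor
    · intro hμ
      by_contra hne
      have hd : 0 < d.dist leb μ := @dist_pos _ d leb μ |>.2 (Ne.symm hne)
      -- With radius `d(leb, μ)`, a point whose only limit measure is `leb` is excluded by the
      -- strict inequality.
      refine (hμ _ hd).ne' (measure_mono_null (fun x hx => ?_) h)
      rintro (hx' : Tendsto _ _ _)
      obtain ⟨ν, hν, hlt⟩ := hx
      have : ν = leb := eq_of_nhds_neBot (ClusterPt.mono hν hx')
      rw [this] at hlt
      exact lt_irrefl _ hlt
    · rintro rfl ε hε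
      refine hpos _ ?_
      filter_upwards [h] with x hx
      refine ⟨leb, hx.mapClusterPt, ?_⟩
      rw [show d.dist leb leb = 0 from d.dist_self leb]
      exact hε
  · ext μ
    constructor
    · rintro ⟨-, hμ⟩
      by_contra hne
      refine hμ.ne' (measure_mono_null (fun x hx => ?_) h)
      rintro (hx' : Tendsto _ _ _)
      exact hne (tendsto_nhds_unique hx hx')
    · rintro rfl
      exact ⟨f.measurePreserving, hpos _ h⟩

theorem generic_obsPhysEqLeb : Generic fun f : ConsHomeo => ObsPhysEqLeb f := by
  let U := {φ : C(Torus, ℝ) // ∀ x, 0 ≤ φ x ∧ φ x ≤ 1}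
  have : Nonempty U := ⟨⟨0, fun x => ⟨le_rfl, zero_le_one⟩⟩⟩
  let φ : ℕ → U := TopologicalSpace.denseSeq U
  let O : ℕ × ℕ → Set ConsHomeo := fun p =>
    {f | ∃ D n, n ≠ 0 ∧ orbitDev (φ p.1).1 f.toHomeo D n < 1 / ((p.2 : ℝ) + 1)}
  have hO : ∀ p, IsOpen (O p) := by
    intro p
    have : O p = ⋃ (D : ℕ) (n : ℕ) (_ : n ≠ 0),
        {f | orbitDev (φ p.1).1 f.toHomeo D n < 1 / ((p.2 : ℝ) + 1)} := by
      ext f; simp [O]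
    rw [this]
    exact isOpen_iUnion fun D => isOpen_iUnion fun n => isOpen_iUnion fun _ =>
      isOpen_lt (ConsHomeo.continuous_orbitDev (fun x => ((φ p.1).2 x).1)
        (fun x => ((φ p.1).2 x).2) D n) continuous_const
  have hOd : ∀ p, Dense (O p) := by
    intro p
    refine Metric.dense_iff.2 fun f r hr => ?_
    obtain ⟨g, hg, hgO⟩ := exists_dist_lt_orbitDev_lt f (fun x => ((φ p.1).2 x).1)
      (fun x => ((φ p.1).2 x).2) hr (η := 1 / ((p.2 : ℝ) + 1)) (by positivity)
    exact ⟨g, hg, hgO⟩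
  refine ⟨⋂ p, O p, .iInter_of_isOpen hO, dense_iInter_of_isOpen hO hOd, fun f hf => ?_⟩
  refine obsPhysEqLeb_of_ae_tendsto f ?_
  have hae : ∀ᵐ x, ∀ i, Tendsto (fun N : ℕ => birkhoffSum f.toHomeo (φ i).1 N x / N) atTop
      (𝓝 (∫ y, (φ i).1 y)) := by
    refine ae_all_iff.2 fun i => ae_tendsto_birkhoffSum_div (fun x => ((φ i).2 x).1)
      (fun x => ((φ i).2 x).2) f.measurePreserving fun η hη => ?_
    obtain ⟨p, hp⟩ := exists_nat_one_div_lt hη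
    obtain ⟨D, n, hn, hlt⟩ := Set.mem_iInter.1 hf (i, p)
    exact ⟨D, n, hn, hlt.trans hp⟩
  filter_upwards [hae] with x hx
  refine tendsto_leb_of_forall_unit (TopologicalSpace.denseRange_denseSeq U) ?_
  rintro _ ⟨i, rfl⟩
  simp only [integral_empirical]
  -- `empirical` at index `n` averages `n + 1` points, hence the shift.
  exact (hx i).comp (tendsto_add_atTop_nat 1)

theorem Generic.subtype_of_isOpen {X : Type*} [TopologicalSpace X] {P Q : X → Prop}
    (h : Generic P) (hQ : IsOpen {x | Q x}) : Generic fun x : {x // Q x} => P x.1 := by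
  obtain ⟨G, hG, hGd, hGP⟩ := h
  exact ⟨Subtype.val ⁻¹' G, hG.preimage continuous_subtype_val,
    hGd.preimage hQ.isOpenMap_subtype_val, fun f hf => hGP _ hf⟩

end TorusDynamics

theorem mainTheorem9 :
    TorusDynamics.Generic
      (fun f : TorusDynamics.ConsHomeo => TorusDynamics.ObsPhysEqLeb f) ∧
    TorusDynamics.Generic
      (fun f : {f : TorusDynamics.ConsHomeo // f.HomotopicToId} =>
        TorusDynamics.ObsPhysEqLeb f.1) :=
  ⟨TorusDynamics.generic_obsPhysEqLeb,
    TorusDynamics.generic_obsPhysEqLeb.subtype_of_isOpen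
      TorusDynamics.ConsHomeo.isOpen_homotopicToId⟩
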